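/- Let $\Omega=\mathbb{R}^{\mathbb{N}}$ with the product topology and its Borel $\sigma$-algebra, let $\xi_k(\omega)=\omega(k)$, $k\ge 1$, be the coordinate maps, $\bar\xi_n=(\xi_1+\cdots+\xi_n)/n$ and $\mathcal{F}_d=\sigma(\xi_1,\dots,\xi_d)$. Let $\mathbb{E}:C_b(\Omega)\to\mathbb{R}$ be a sublinear expectation (monotone, constant preserving, subadditive, positively homogeneous) which is regular, i.e. $\mathbb{E}[X_n]\downarrow 0$ whenever $X_n\in C_b(\Omega)$ and $X_n\downarrow 0$ pointwise. Let $\Theta$ be the set of all Borel probability measures $P$ on $\Omega$ with $E_P[X]\le\mathbb{E}[X]$ for all $X\in C_b(\Omega)$, and extend $\mathbb{E}$ by $\mathbb{E}[X]=\sup_{P\in\Theta}E_P[X]$ to $L^p_{\mathbb{E}}(\Omega)$, $p\ge 1$, the completion of $C_b(\Omega)$ under $\|X\|_p=\big(\sup_{P\in\Theta}E_P[|X|^p]\big)^{1/p}$ (realized as the measurable functions that are limits of functions in $C_b(\Omega)$ in this norm). Assume that $\xi_k\in L^{\gamma}_{\mathbb{E}}(\Omega)$ for all $k$, for some $\gamma>1$,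 and that $(\xi_k)_{k\ge1}$ is i.i.d. under $\mathbb{E}$: for every $k\ge 1$, $\mathbb{E}[\varphi(\xi_{k+1})]=\mathbb{E}[\varphi(\xi_k)]$ for all bounded Lipschitz $\varphi:\mathbb{R}\to\mathbb{R}$, and $\xi_{k+1}$ is independent of $(\xi_1,\dots,\xi_k)$, i.e. $$\mathbb{E}[\varphi(\xi_1,\dots,\xi_k,\xi_{k+1})]=\mathbb{E}\big[\mathbb{E}[\varphi(y_1,\dots,y_k,\xi_{k+1})]\big|_{y_1=\xi_1,\dots,y_k=\xi_k}\big]$$ for all bounded Lipschitz $\varphi:\mathbb{R}^{k+1}\to\mathbb{R}$. Put $\overline\mu=\mathbb{E}[\xi_1]$, $\underline\mu=-\mathbb{E}[-\xi_1]$. Theorem. Let $d\in\mathbb{N}$, let $\pi:\mathbb{R}^d\to[\underline\mu,\overline\mu]$ be Borel measurable, $\Pi=\pi(\xi_1,\dots,\xi_d)$, and let $P\in\Theta$. Then there exists $P^{\Pi}\in\Theta$ such that $P^{\Pi}=P$ on $\mathcal{F}_d$ and $$\lim_{n\to\infty}\bar\xi_n=\Pi\qquad P^{\Pi}\text{-a.s.}$$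 Moreover, if $P\circ(\xi_1,\dots,\xi_d)^{-1}$ is an extreme point of the convex set $\Xi_d=\{Q\circ(\xi_1,\dots,\xi_d)^{-1} : Q\in\Theta\}$, then $P^{\Pi}$ with these properties can be chosen to be an extreme point of $\Theta$. -/

import Mathlib

open MeasureTheory Filter Topology
open scoped BoundedContinuousFunction NNReal ENNReal

/-- A sublinear expectation on `(Ω, C_b(Ω))`: a monotone, constant preserving, subadditive and
positively homogeneous real functional on the bounded continuous functions. -/
structure SublinearExpectation (Ω : Type*) [TopologicalSpace Ω] where
  toFun : (Ω →ᵇ ℝ) → ℝ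
  mono' : ∀ X Y : Ω →ᵇ ℝ, (∀ ω, X ω ≤ Y ω) → toFun X ≤ toFun Y
  map_const' : ∀ c : ℝ, toFun (BoundedContinuousFunction.const Ω c) = c
  subadd' : ∀ X Y : Ω →ᵇ ℝ, toFun (X + Y) ≤ toFun X + toFun Y
  pos_homog' : ∀ (c : ℝ) (X : Ω →ᵇ ℝ), 0 ≤ c → toFun (c • X) = c * toFun X

namespace SublinearExpectation

section General

variable {Ω : Type*} [TopologicalSpace Ω]

instance : CoeFun (SublinearExpectation Ω) (fun _ => (Ω →ᵇ ℝ) → ℝ) := ⟨toFun⟩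

/-- `𝔼` is regular: `𝔼[X n] ↓ 0` whenever `X n ∈ C_b(Ω)` decreases pointwise to `0`. -/
def IsRegular (E : SublinearExpectation Ω) : Prop :=
  ∀ X : ℕ → (Ω →ᵇ ℝ), Antitone X → (∀ ω, Tendsto (fun n => X n ω) atTop (𝓝 0)) →
    Tendsto (fun n => E (X n)) atTop (𝓝 0)

theorem le_add_of_forall_le (E : SublinearExpectation Ω) {X Y : Ω →ᵇ ℝ} {c : ℝ}
    (h : ∀ ω, X ω ≤ Y ω + c) : E X ≤ E Y + c := by
  have h1 := E.mono' X (Y + BoundedContinuousFunction.const Ω c) (fun ω => by simpa using h ω)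
  have h2 := E.subadd' Y (BoundedContinuousFunction.const Ω c)
  rw [E.map_const'] at h2
  exact h1.trans h2

theorem abs_sub_le_of_forall (E : SublinearExpectation Ω) {X Y : Ω →ᵇ ℝ} {c : ℝ}
    (h : ∀ ω, |X ω - Y ω| ≤ c) : |E X - E Y| ≤ c := by
  have h1 : E X ≤ E Y + c :=
    E.le_add_of_forall_le (fun ω => by linarith [(abs_le.1 (h ω)).2])
  have h2 : E Y ≤ E X + c :=
    E.le_add_of_forall_le (fun ω => by linarith [(abs_le.1 (h ω)).1])
  exact abs_le.2 ⟨by linarith, by linarith⟩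

theorem abs_le_of_forall (E : SublinearExpectation Ω) {X : Ω →ᵇ ℝ} {c : ℝ}
    (h : ∀ ω, |X ω| ≤ c) : |E X| ≤ c := by
  have h0 := E.map_const' 0
  have := E.abs_sub_le_of_forall (X := X) (Y := BoundedContinuousFunction.const Ω 0) (c := c)
    (fun ω => by simpa using h ω)
  rwa [h0, sub_zero] at this

variable {α β : Type*} [PseudoMetricSpace α] [PseudoMetricSpace β]

/-- The bounded continuous function `ω ↦ φ (y, X ω)`, with `y` frozen. -/
def frozen (X : C(Ω, α)) (φ : (β × α) →ᵇ ℝ) (y : β) : Ω →ᵇ ℝ :=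
  φ.compContinuous ((ContinuousMap.const Ω y).prodMk X)

theorem continuous_apply_frozen (E : SublinearExpectation Ω) (X : C(Ω, α)) (φ : (β × α) →ᵇ ℝ)
    (hφ : ∃ K : ℝ≥0, LipschitzWith K φ) : Continuous (fun y : β => E (frozen X φ y)) := by
  obtain ⟨K, hK⟩ := hφ
  refine (LipschitzWith.of_dist_le_mul (K := K) fun y z => ?_).continuous
  rw [Real.dist_eq]
  refine E.abs_sub_le_of_forall fun ω => ?_
  have h := hK.dist_le_mul (y, X ω) (z, X ω)
  rw [Real.dist_eq, Prod.dist_eq] at h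
  simpa [frozen] using h

/-- The function `y ↦ 𝔼[φ (y, X)]`, for `φ` bounded and Lipschitz. -/
noncomputable def partialExp (E : SublinearExpectation Ω) (X : C(Ω, α)) (φ : (β × α) →ᵇ ℝ)
    (hφ : ∃ K : ℝ≥0, LipschitzWith K φ) : β →ᵇ ℝ :=
  BoundedContinuousFunction.ofNormedAddCommGroup (fun y => E (frozen X φ y))
    (E.continuous_apply_frozen X φ hφ) ‖φ‖
    (fun y => E.abs_le_of_forall fun ω => φ.norm_coe_le_norm (y, X ω))

/-- `X` is independent of `Y` under `𝔼`: for all bounded Lipschitz `φ`,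
`𝔼[φ (Y, X)] = 𝔼[𝔼[φ (y, X)]|_{y = Y}]`. -/
def IndepOf (E : SublinearExpectation Ω) (X : C(Ω, α)) (Y : C(Ω, β)) : Prop :=
  ∀ (φ : (β × α) →ᵇ ℝ) (hφ : ∃ K : ℝ≥0, LipschitzWith K φ),
    E (φ.compContinuous (Y.prodMk X)) = E ((E.partialExp X φ hφ).compContinuous Y)

/-- `X` and `Y` are identically distributed under `𝔼`: `𝔼[φ (X)] = 𝔼[φ (Y)]` for all bounded
Lipschitz `φ`. -/
def SameLaw (E : SublinearExpectation Ω) (X Y : C(Ω, α)) : Prop :=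
  ∀ φ : α →ᵇ ℝ, (∃ K : ℝ≥0, LipschitzWith K φ) →
    E (φ.compContinuous X) = E (φ.compContinuous Y)

variable [MeasurableSpace Ω]

/-- The set `Θ` of all probability measures `P` with `E_P[X] ≤ 𝔼[X]` for every `X ∈ C_b(Ω)`. -/
def Theta (E : SublinearExpectation Ω) : Set (Measure Ω) :=
  {P | IsProbabilityMeasure P ∧ ∀ X : Ω →ᵇ ℝ, ∫ ω, X ω ∂P ≤ E X}

/-- The `L^p`-norm under `𝔼`: `(sup_{P ∈ Θ} E_P[|f|^p])^{1/p}`, with values in `[0, ∞]`. -/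
noncomputable def upperLpNorm (E : SublinearExpectation Ω) (p : ℝ) (f : Ω → ℝ) : ℝ≥0∞ :=
  (⨆ P ∈ E.Theta, ∫⁻ ω, ‖f ω‖ₑ ^ p ∂P) ^ (1 / p)

/-- `f` belongs to `L^p_𝔼(Ω)`, the completion of `C_b(Ω)` in the `L^p`-norm under `𝔼`: `f` is
measurable and is a limit of bounded continuous functions in this norm. -/
def MemLpE (E : SublinearExpectation Ω) (p : ℝ) (f : Ω → ℝ) : Prop :=
  Measurable f ∧ ∀ ε : ℝ≥0∞, 0 < ε → ∃ g : Ω →ᵇ ℝ, E.upperLpNorm p (fun ω => f ω - g ω) < ε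

/-- `𝔼[f] = sup_{P ∈ Θ} E_P[f]` for a function `f ∈ L^1_𝔼(Ω)`. -/
noncomputable def upperExp (E : SublinearExpectation Ω) (f : Ω → ℝ) : ℝ :=
  sSup ((fun P : Measure Ω => ∫ ω, f ω ∂P) '' E.Theta)

end General

end SublinearExpectation

/-! The canonical space `Ω = ℝ^ℕ`. Coordinates are numbered from `0`: the random variable `ξ_{k+1}`
is `coord k`. -/

/-- The canonical random variable `ξ_{k+1}` on `ℝ^ℕ`. -/
def coord (k : ℕ) : C(ℕ → ℝ, ℝ) := ⟨fun ω => ω k, continuous_apply k⟩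

/-- The random vector `(ξ_1, …, ξ_d)` on `ℝ^ℕ`. -/
def firstCoords (d : ℕ) : C(ℕ → ℝ, Fin d → ℝ) :=
  ⟨fun ω i => ω i, continuous_pi fun i => continuous_apply (i : ℕ)⟩

/-- `𝓕_d = σ(ξ_1, …, ξ_d)`. -/
@[reducible] def sigmaFirst (d : ℕ) : MeasurableSpace (ℕ → ℝ) :=
  MeasurableSpace.comap (firstCoords d) inferInstance

/-- The empirical average `(ξ_1 + ⋯ + ξ_n) / n`. -/
noncomputable def empAvg (n : ℕ) (ω : ℕ → ℝ) : ℝ := (∑ k ∈ Finset.range n, coord k ω) / n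

namespace SublinearExpectation

/-- The canonical sequence is i.i.d. under `𝔼`: `ξ_{n+1}` is independent of `(ξ_1, …, ξ_n)`, and
`ξ_{n+2}` and `ξ_{n+1}` are identically distributed, for all `n`. -/
def CanonicalIID (E : SublinearExpectation (ℕ → ℝ)) : Prop :=
  (∀ n, E.IndepOf (coord n) (firstCoords n)) ∧ ∀ n, E.SameLaw (coord (n + 1)) (coord n)

/-- `μ̅ = 𝔼[ξ_1]`. -/
noncomputable def muUpper (E : SublinearExpectation (ℕ → ℝ)) : ℝ := E.upperExp (coord 0)

/-- `μ̲ = -𝔼[-ξ_1]`. -/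
noncomputable def muLower (E : SublinearExpectation (ℕ → ℝ)) : ℝ :=
  -E.upperExp (fun ω => -coord 0 ω)

/-- `Ξ_d`, the set of the laws of `(ξ_1, …, ξ_d)` under the elements of `Θ`. -/
def Xi (E : SublinearExpectation (ℕ → ℝ)) (d : ℕ) : Set (Measure (Fin d → ℝ)) :=
  (fun P : Measure (ℕ → ℝ) => P.map (firstCoords d)) '' E.Theta

end SublinearExpectation

/-! Among the laws that the first coordinate can have under Θ (`marginals`), choose extreme points
ν₁ of largest mean μ̅ and ν₂ of smallest mean μ̲. Keep the first d coordinates of P and continue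
with independent draws from ν₁ or ν₂, the choice at each time being a function of the first d
coordinates only. If μ̲ < μ̅ and ν₁ is used with asymptotic frequency τ = (π - μ̲)/(μ̅ - μ̲), the
strong law, applied to the two groups of draws separately, gives the limit τ μ̅ + (1 - τ) μ̲ = π.

The new measure is in Θ (`spliceMeasure_mem_Theta`): by independence under 𝔼, domination passes from
k to k + 1 coordinates when the conditional law of the next one is in `marginals`, and regularity
reduces C_b to Lipschitz functions of finitely many coordinates (`mem_Theta_of_firstCoords`).

For extremality (`spliceMeasure_mem_extremePoints`), conversely, under any Q ∈ Θ the conditional law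
of the next coordinate given a past event is in `marginals`. If two components of the new measure
agree with it on the past, their conditional laws average to the extreme point ν₁ or ν₂, hence equal
it.

Such ν₁, ν₂ exist (`exists_extremePoints_isMax`) because a moment of order γ > 1 makes `marginals`
weakly compact and the mean continuous on it; Krein–Milman applies to the face of extremal mean. -/

/-! ### Reduction of Θ to Lipschitz functions of finitely many coordinates. -/

theorem firstCoords_apply (d : ℕ) (ω : ℕ → ℝ) (i : Fin d) : firstCoords d ω i = ω i := rfl

theorem coord_apply (k : ℕ) (ω : ℕ → ℝ) : coord k ω = ω k := rfl

theorem exists_firstCoords_eq {d : ℕ} (y : Fin d → ℝ) : ∃ ω, firstCoords d ω = y :=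
  ⟨fun k => if h : k < d then y ⟨k, h⟩ else 0, by ext i; simp [firstCoords_apply]⟩

theorem dist_firstCoords_mono (ω ω' : ℕ → ℝ) :
    Monotone fun n => dist (firstCoords n ω) (firstCoords n ω') := by
  intro m n hmn
  refine (dist_pi_le_iff dist_nonneg).2 fun i => ?_
  exact dist_le_pi_dist (firstCoords n ω) (firstCoords n ω') ⟨i, i.2.trans_le hmn⟩

/-- The sup-convolution of `X` with `n` times the distance of the first `n` coordinates. -/
noncomputable def supConv (X : (ℕ → ℝ) →ᵇ ℝ) (n : ℕ) (y : Fin n → ℝ) : ℝ :=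
  ⨆ ω, (X ω - n * dist y (firstCoords n ω))

section supConv

variable (X : (ℕ → ℝ) →ᵇ ℝ) (n : ℕ)

theorem supConv_term_le (y : Fin n → ℝ) (ω : ℕ → ℝ) :
    X ω - n * dist y (firstCoords n ω) ≤ ‖X‖ := by
  have h1 := X.apply_le_norm ω
  have h2 : 0 ≤ (n : ℝ) * dist y (firstCoords n ω) := by positivity
  linarith

theorem bddAbove_supConv (y : Fin n → ℝ) :
    BddAbove (Set.range fun ω => X ω - n * dist y (firstCoords n ω)) :=
  ⟨‖X‖, by rintro _ ⟨ω, rfl⟩; exact supConv_term_le X n y ω⟩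

theorem le_supConv (ω : ℕ → ℝ) : X ω ≤ supConv X n (firstCoords n ω) := by
  have := le_ciSup (bddAbove_supConv X n (firstCoords n ω)) ω
  simpa [supConv] using this

theorem abs_supConv_le (y : Fin n → ℝ) : |supConv X n y| ≤ ‖X‖ := by
  refine abs_le.2 ⟨?_, ciSup_le fun ω => supConv_term_le X n y ω⟩
  obtain ⟨ω, rfl⟩ := exists_firstCoords_eq y
  exact (X.neg_norm_le_apply ω).trans (le_supConv X n ω)

theorem lipschitzWith_supConv : LipschitzWith n (supConv X n) := by
  refine LipschitzWith.of_le_add_mul _ fun x y => ?_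
  refine ciSup_le fun ω => ?_
  have h1 := le_ciSup (bddAbove_supConv X n y) ω
  have h2 : (n : ℝ) * dist y (firstCoords n ω) ≤ n * (dist x y + dist x (firstCoords n ω)) :=
    mul_le_mul_of_nonneg_left (dist_triangle_left _ _ _) n.cast_nonneg
  simp only [NNReal.coe_natCast]
  change _ ≤ supConv X n y at h1
  linarith

/-- `supConv X n` as a bounded continuous function. -/
noncomputable def supConvBCF : (Fin n → ℝ) →ᵇ ℝ :=
  BoundedContinuousFunction.ofNormedAddCommGroup (supConv X n)
    (lipschitzWith_supConv X n).continuous ‖X‖ (abs_supConv_le X n)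

/-- The penalty grows with n both through the factor and through the distance. -/
theorem antitone_supConv (ω : ℕ → ℝ) : Antitone fun n => supConv X n (firstCoords n ω) := by
  intro m n hmn
  refine ciSup_mono (bddAbove_supConv X m _) fun ω' => ?_
  have h := dist_firstCoords_mono ω ω' hmn
  have : (m : ℝ) ≤ n := by exact_mod_cast hmn
  have := mul_le_mul this h dist_nonneg n.cast_nonneg
  linarith

/-- As `X` is bounded, a near-maximizer `u n` must agree with `ω` up to O(1/n) in the first n
coordinates. Hence `u n` tends to `ω` in the product topology, and continuity of `X` bounds the
limit from above. -/
theorem tendsto_supConv (ω : ℕ → ℝ) :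
    Tendsto (fun n => supConv X n (firstCoords n ω)) atTop (𝓝 (X ω)) := by
  have hex : ∀ n : ℕ, ∃ ω', supConv X n (firstCoords n ω) - 1 / ((n : ℝ) + 1) <
      X ω' - n * dist (firstCoords n ω) (firstCoords n ω') := fun n =>
    exists_lt_of_lt_ciSup (sub_lt_self _ Nat.one_div_pos_of_nat)
  choose u hu using hex
  have hdist : ∀ n : ℕ, 0 < n →
      dist (firstCoords n ω) (firstCoords n (u n)) ≤ (2 * ‖X‖ + 1) / n := by
    intro n hn
    have hn' : (0 : ℝ) < n := by exact_mod_cast hn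
    rw [le_div_iff₀ hn']
    have h1 := hu n
    have h2 := X.apply_le_norm (u n)
    have h3 := (abs_le.1 (abs_supConv_le X n (firstCoords n ω))).1
    have h4 : 1 / ((n : ℝ) + 1) ≤ 1 := by
      rw [div_le_one (by positivity)]; linarith
    linarith
  have hlim : Tendsto u atTop (𝓝 ω) := by
    refine tendsto_pi_nhds.2 fun k => ?_
    refine tendsto_iff_dist_tendsto_zero.2 ?_
    refine squeeze_zero' (Eventually.of_forall fun _ => dist_nonneg) ?_
      (tendsto_const_div_atTop_nhds_zero_nat (2 * ‖X‖ + 1))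
    filter_upwards [eventually_gt_atTop k] with n hn
    rw [dist_comm]
    exact (dist_le_pi_dist (firstCoords n ω) (firstCoords n (u n)) ⟨k, hn⟩).trans
      (hdist n (by omega))
  have hup : Tendsto (fun n : ℕ => X (u n) + 1 / ((n : ℝ) + 1)) atTop (𝓝 (X ω)) := by
    simpa using ((X.continuous.tendsto ω).comp hlim).add tendsto_one_div_add_atTop_nhds_zero_nat
  refine tendsto_of_tendsto_of_tendsto_of_le_of_le tendsto_const_nhds hup
    (fun n => le_supConv X n ω) fun n => ?_
  have h1 := hu n
  have h2 : 0 ≤ (n : ℝ) * dist (firstCoords n ω) (firstCoords n (u n)) := by positivity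
  change _ ≤ X (u n) + 1 / ((n : ℝ) + 1)
  linarith

end supConv

namespace SublinearExpectation

variable {E : SublinearExpectation (ℕ → ℝ)}

/-- The sup-convolutions `Y n` are Lipschitz cylinder functions decreasing to `X`, so 𝔼[Y n] ≤ 𝔼[X]
+ 𝔼[Y n - X], and regularity kills the last term. -/
theorem mem_Theta_of_firstCoords (hreg : E.IsRegular) {Q : Measure (ℕ → ℝ)}
    [IsProbabilityMeasure Q]
    (h : ∀ (k : ℕ) (φ : (Fin k → ℝ) →ᵇ ℝ), (∃ K : ℝ≥0, LipschitzWith K φ) →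
      ∫ ω, φ (firstCoords k ω) ∂Q ≤ E (φ.compContinuous (firstCoords k))) :
    Q ∈ E.Theta := by
  refine ⟨inferInstance, fun X => ?_⟩
  let Y : ℕ → ((ℕ → ℝ) →ᵇ ℝ) := fun n => (supConvBCF X n).compContinuous (firstCoords n)
  have hY : ∀ n ω, Y n ω = supConv X n (firstCoords n ω) := fun _ _ => rfl
  have hlim := hreg (fun n => Y n - X)
    (fun m n hmn ω => by
      have := antitone_supConv X ω hmn
      simpa [hY] using this)
    (fun ω => by
      have := (tendsto_supConv X ω).sub_const (X ω)
      simpa [hY] using this)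
  have hle : ∀ n, ∫ ω, X ω ∂Q ≤ E X + E (Y n - X) := by
    intro n
    calc ∫ ω, X ω ∂Q ≤ ∫ ω, Y n ω ∂Q :=
          integral_mono (X.integrable Q) ((Y n).integrable Q) fun ω => le_supConv X n ω
      _ ≤ E (Y n) := h n (supConvBCF X n) ⟨n, lipschitzWith_supConv X n⟩
      _ = E (X + (Y n - X)) := by rw [add_sub_cancel]
      _ ≤ E X + E (Y n - X) := E.subadd' _ _
  have := ge_of_tendsto' (hlim.const_add (E X)) hle
  simpa using this

end SublinearExpectation

/-! ### The spliced measure and its one-step disintegration. -/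

section splice

open ProbabilityTheory Classical

variable {d : ℕ}

/-- The sequence with the first `d` terms of `p.1`, continued by `(p.2 k).1` if the first `d` terms
lie in `A k`, and by `(p.2 k).2` otherwise. -/
noncomputable def splice (A : ℕ → Set (Fin d → ℝ)) (p : (ℕ → ℝ) × (ℕ → ℝ × ℝ)) (k : ℕ) : ℝ :=
  if k < d then p.1 k else if firstCoords d p.1 ∈ A k then (p.2 k).1 else (p.2 k).2

/-- The law of `splice A`, when the second argument is i.i.d. with law `ν₁ ⊗ ν₂`. -/
noncomputable def spliceMeasure (A : ℕ → Set (Fin d → ℝ)) (P : Measure (ℕ → ℝ))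
    (ν₁ ν₂ : Measure ℝ) [IsProbabilityMeasure ν₁] [IsProbabilityMeasure ν₂] :
    Measure (ℕ → ℝ) :=
  (P.prod (Measure.infinitePi fun _ : ℕ => ν₁.prod ν₂)).map (splice A)

/-- The vectors of length `k` whose first `d` entries lie in `A`. -/
def liftSet {k : ℕ} (h : d ≤ k) (A : Set (Fin d → ℝ)) : Set (Fin k → ℝ) :=
  {y | (fun i : Fin d => y (Fin.castLE h i)) ∈ A}

theorem measurableSet_liftSet {k : ℕ} (h : d ≤ k) {A : Set (Fin d → ℝ)} (hA : MeasurableSet A) :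
    MeasurableSet (liftSet h A) :=
  hA.preimage (measurable_pi_lambda _ fun _ => measurable_pi_apply _)

theorem firstCoords_splice (A : ℕ → Set (Fin d → ℝ)) (p : (ℕ → ℝ) × (ℕ → ℝ × ℝ)) :
    firstCoords d (splice A p) = firstCoords d p.1 := by
  ext i
  simp [firstCoords_apply, splice]

theorem firstCoords_mem_liftSet {k : ℕ} (h : d ≤ k) (A : Set (Fin d → ℝ)) (ω : ℕ → ℝ) :
    firstCoords k ω ∈ liftSet h A ↔ firstCoords d ω ∈ A := Iff.rfl

variable {A : ℕ → Set (Fin d → ℝ)} (hA : ∀ k, MeasurableSet (A k))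

include hA in
theorem measurable_splice : Measurable (splice A) := by
  refine measurable_pi_lambda _ fun k => ?_
  unfold splice
  split_ifs
  · fun_prop
  · refine Measurable.ite ?_ (by fun_prop) (by fun_prop)
    exact (hA k).preimage ((firstCoords d).continuous.measurable.comp measurable_fst)

variable (P : Measure (ℕ → ℝ)) [IsProbabilityMeasure P] (ν₁ ν₂ : Measure ℝ)
  [IsProbabilityMeasure ν₁] [IsProbabilityMeasure ν₂]

include hA in
theorem isProbabilityMeasure_spliceMeasure : IsProbabilityMeasure (spliceMeasure A P ν₁ ν₂) :=
  Measure.isProbabilityMeasure_map (measurable_splice hA).aemeasurable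

omit [IsProbabilityMeasure P] in
include hA in
theorem spliceMeasure_map_firstCoords :
    (spliceMeasure A P ν₁ ν₂).map (firstCoords d) = P.map (firstCoords d) := by
  have hm : Measurable (firstCoords d) := (firstCoords d).continuous.measurable
  rw [spliceMeasure, Measure.map_map hm (measurable_splice hA)]
  have : (firstCoords d) ∘ splice A = firstCoords d ∘ Prod.fst := by
    ext1 p; exact firstCoords_splice A p
  rw [this, ← Measure.map_map hm measurable_fst, Measure.map_fst_prod]
  simp

/-- With `ω` frozen, the first k coordinates use only the draws `w i` with i < k. -/
theorem indepFun_firstCoords_splice {k : ℕ} (ω : ℕ → ℝ) :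
    IndepFun (fun w : ℕ → ℝ × ℝ => firstCoords k (splice A (ω, w))) (fun w => w k)
      (Measure.infinitePi fun _ : ℕ => ν₁.prod ν₂) := by
  have hind : iIndepFun (fun (i : ℕ) (w : ℕ → ℝ × ℝ) => w i)
      (Measure.infinitePi fun _ : ℕ => ν₁.prod ν₂) :=
    iIndepFun_infinitePi (X := fun _ x => x) fun _ => measurable_id
  have h := hind.indepFun_finset (Finset.range k) {k} (by simp) fun i => measurable_pi_apply i
  let G : ((i : Finset.range k) → ℝ × ℝ) → Fin k → ℝ := fun v i =>
    if (i : ℕ) < d then ω i else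
      if firstCoords d ω ∈ A i then (v ⟨i, Finset.mem_range.2 i.2⟩).1
      else (v ⟨i, Finset.mem_range.2 i.2⟩).2
  have hG : Measurable G := by
    refine measurable_pi_lambda _ fun i => ?_
    simp only [G]
    split_ifs <;> fun_prop
  exact h.comp (φ := G)
    (ψ := fun v : ({k} : Finset ℕ) → ℝ × ℝ => v ⟨k, Finset.mem_singleton_self k⟩) hG
    (measurable_pi_apply (⟨k, Finset.mem_singleton_self k⟩ : ({k} : Finset ℕ)))

-- Since d ≤ k, the event deciding between ν₁ and ν₂ at time k is visible in the first k
-- coordinates; given these, the next one has the selected law.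
include hA in
theorem spliceMeasure_map_prod {k : ℕ} (h : d ≤ k) :
    (spliceMeasure A P ν₁ ν₂).map (fun ω => (firstCoords k ω, coord k ω)) =
      (((spliceMeasure A P ν₁ ν₂).map (firstCoords k)).restrict (liftSet h (A k))).prod ν₁ +
      (((spliceMeasure A P ν₁ ν₂).map (firstCoords k)).restrict (liftSet h (A k))ᶜ).prod ν₂ := by
  have := isProbabilityMeasure_spliceMeasure hA P ν₁ ν₂
  have hm : Measurable (firstCoords k) := (firstCoords k).continuous.measurable
  have hc : Measurable (coord k) := (coord k).continuous.measurable
  have hT := measurable_splice hA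
  have hB := measurableSet_liftSet h (hA k)
  have := Measure.isProbabilityMeasure_map (μ := spliceMeasure A P ν₁ ν₂) hm.aemeasurable
  have := Measure.isProbabilityMeasure_map (μ := spliceMeasure A P ν₁ ν₂)
    (hm.prodMk hc).aemeasurable
  set W : Measure (ℕ → ℝ × ℝ) := Measure.infinitePi fun _ : ℕ => ν₁.prod ν₂ with hW
  have hWk : W.map (fun w => w k) = ν₁.prod ν₂ := Measure.infinitePi_map_eval _ k
  have hfst : ∀ t, MeasurableSet t → W {w | (w k).1 ∈ t} = ν₁ t := by
    intro t ht
    have : W ((fun w => w k) ⁻¹' (t ×ˢ Set.univ)) = ν₁ t := by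
      rw [← Measure.map_apply (measurable_pi_apply k) (ht.prod .univ), hWk, Measure.prod_prod]
      simp
    rw [← this]; congr 1; ext w; simp
  have hsnd : ∀ t, MeasurableSet t → W {w | (w k).2 ∈ t} = ν₂ t := by
    intro t ht
    have : W ((fun w => w k) ⁻¹' (Set.univ ×ˢ t)) = ν₂ t := by
      rw [← Measure.map_apply (measurable_pi_apply k) (MeasurableSet.univ.prod ht), hWk,
        Measure.prod_prod]
      simp
    rw [← this]; congr 1; ext w; simp
  refine Measure.ext_prod fun {s} {t} hs ht => ?_
  have hlaw : ∀ s, MeasurableSet s → (spliceMeasure A P ν₁ ν₂).map (firstCoords k) s =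
      ∫⁻ ω, W {w | firstCoords k (splice A (ω, w)) ∈ s} ∂P := by
    intro s hs
    rw [Measure.map_apply hm hs, spliceMeasure, Measure.map_apply hT (hm hs),
      Measure.prod_apply (hT (hm hs))]
    rfl
  have hmeas : ∀ s, MeasurableSet s →
      Measurable fun ω => W {w | firstCoords k (splice A (ω, w)) ∈ s} := fun s hs =>
    measurable_measure_prodMk_left (hT (hm hs))
  rw [Measure.map_apply (hm.prodMk hc) (hs.prod ht), Measure.add_apply, Measure.prod_prod,
    Measure.prod_prod, Measure.restrict_apply hs, Measure.restrict_apply hs,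
    hlaw _ (hs.inter hB), hlaw _ (hs.inter hB.compl),
    ← lintegral_mul_const _ (hmeas _ (hs.inter hB)),
    ← lintegral_mul_const _ (hmeas _ (hs.inter hB.compl)),
    ← lintegral_add_left ((hmeas _ (hs.inter hB)).mul_const _), spliceMeasure,
    Measure.map_apply hT (hm.prodMk hc (hs.prod ht)),
    Measure.prod_apply (hT (hm.prodMk hc (hs.prod ht)))]
  refine lintegral_congr fun ω => ?_
  have hind := indepFun_firstCoords_splice (A := A) ν₁ ν₂ (k := k) ω
  rw [← hW] at hind
  have hmem : ∀ w, firstCoords k (splice A (ω, w)) ∈ liftSet h (A k) ↔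
      firstCoords d ω ∈ A k := fun w => by
    rw [firstCoords_mem_liftSet, firstCoords_splice]
  have hk : ¬ k < d := by omega
  -- For frozen `ω` the choice of law does not depend on `w`, so one of the two summands vanishes.
  by_cases hω : firstCoords d ω ∈ A k
  · have h1 := hind.measure_inter_preimage_eq_mul s (t ×ˢ Set.univ) hs (ht.prod .univ)
    have h2 : W ((fun w => w k) ⁻¹' (t ×ˢ Set.univ)) = ν₁ t := by
      rw [← hfst t ht]; congr 1; ext w; simp
    rw [h2] at h1
    convert h1 using 1
    · congr 1
      ext w
      simp [coord_apply, splice, hω, hk]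
    · simp [hmem, hω, Set.preimage]
  · have h1 := hind.measure_inter_preimage_eq_mul s (Set.univ ×ˢ t) hs (MeasurableSet.univ.prod ht)
    have h2 : W ((fun w => w k) ⁻¹' (Set.univ ×ˢ t)) = ν₂ t := by
      rw [← hsnd t ht]; congr 1; ext w; simp
    rw [h2] at h1
    convert h1 using 1
    · congr 1
      ext w
      simp [coord_apply, splice, hω, hk]
    · simp [hmem, hω, Set.preimage]

end splice

/-! ### The spliced measure belongs to Θ. -/

theorem snoc_firstCoords (k : ℕ) (ω : ℕ → ℝ) :
    (Fin.snoc (firstCoords k ω) (coord k ω) : Fin (k + 1) → ℝ) = firstCoords (k + 1) ω := by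
  ext i
  refine Fin.lastCases ?_ (fun j => ?_) i
  · simp [firstCoords_apply, coord_apply]
  · simp [firstCoords_apply]

theorem lipschitzWith_snoc (k : ℕ) :
    LipschitzWith 1 fun p : (Fin k → ℝ) × ℝ => (Fin.snoc p.1 p.2 : Fin (k + 1) → ℝ) := by
  refine LipschitzWith.of_dist_le_mul fun p q => ?_
  rw [NNReal.coe_one, one_mul]
  refine (dist_pi_le_iff dist_nonneg).2 fun i => ?_
  refine Fin.lastCases ?_ (fun j => ?_) i
  · simp only [Fin.snoc_last]
    exact le_max_right (dist p.1 q.1) (dist p.2 q.2)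
  · simp only [Fin.snoc_castSucc]
    exact (dist_le_pi_dist p.1 q.1 j).trans (le_max_left _ (dist p.2 q.2))

theorem measurable_firstCoords (k : ℕ) : Measurable (firstCoords k) :=
  (firstCoords k).continuous.measurable

theorem measurable_coord (k : ℕ) : Measurable (coord k) := (coord k).continuous.measurable

namespace SublinearExpectation

variable {E : SublinearExpectation (ℕ → ℝ)}

/-- The probability measures on `ℝ` dominated by the law of the first coordinate under `E`. -/
def marginals (E : SublinearExpectation (ℕ → ℝ)) : Set (Measure ℝ) :=
  {ν | IsProbabilityMeasure ν ∧ ∀ ψ : ℝ →ᵇ ℝ, (∃ K : ℝ≥0, LipschitzWith K ψ) →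
    ∫ x, ψ x ∂ν ≤ E (ψ.compContinuous (coord 0))}

theorem CanonicalIID.apply_coord (h : E.CanonicalIID) (k : ℕ) (ψ : ℝ →ᵇ ℝ)
    (hψ : ∃ K : ℝ≥0, LipschitzWith K ψ) :
    E (ψ.compContinuous (coord k)) = E (ψ.compContinuous (coord 0)) := by
  induction k with
  | zero => rfl
  | succ k ih => rw [h.2 k ψ hψ, ih]

theorem map_coord_mem_marginals {P : Measure (ℕ → ℝ)} (hP : P ∈ E.Theta) :
    P.map (coord 0) ∈ E.marginals := by
  have := hP.1
  refine ⟨Measure.isProbabilityMeasure_map (measurable_coord 0).aemeasurable, fun ψ _ => ?_⟩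
  rw [integral_map (measurable_coord 0).aemeasurable ψ.continuous.aestronglyMeasurable]
  exact hP.2 (ψ.compContinuous (coord 0))

theorem integral_le_partialExp (hiid : E.CanonicalIID) {ν : Measure ℝ} (hν : ν ∈ E.marginals)
    {β : Type*} [PseudoMetricSpace β] (k : ℕ) (φ : (β × ℝ) →ᵇ ℝ)
    (hφ : ∃ K : ℝ≥0, LipschitzWith K φ) (y : β) :
    ∫ x, φ (y, x) ∂ν ≤ E.partialExp (coord k) φ hφ y := by
  obtain ⟨K, hK⟩ := hφ
  let ψ : ℝ →ᵇ ℝ := φ.compContinuous ((ContinuousMap.const ℝ y).prodMk (ContinuousMap.id ℝ))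
  have hψ : LipschitzWith (K * 1) ψ := hK.comp (LipschitzWith.prodMk_left y)
  have h := hν.2 ψ ⟨_, hψ⟩
  rw [← hiid.apply_coord k ψ ⟨_, hψ⟩] at h
  exact h

/-- Keeps the partial expectation among the Lipschitz test functions, so that an inductive
hypothesis restricted to them applies to it. -/
theorem lipschitzWith_partialExp {α β : Type*} [PseudoMetricSpace α] [PseudoMetricSpace β]
    (X : C(ℕ → ℝ, α)) (φ : (β × α) →ᵇ ℝ) {K : ℝ≥0} (hK : LipschitzWith K φ) :
    LipschitzWith K (E.partialExp X φ ⟨K, hK⟩) := by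
  refine LipschitzWith.of_dist_le_mul fun y z => ?_
  rw [Real.dist_eq]
  refine E.abs_sub_le_of_forall fun ω => ?_
  have h := hK.dist_le_mul (y, X ω) (z, X ω)
  rw [Real.dist_eq, Prod.dist_eq] at h
  simpa [frozen] using h

/-- Domination of the first `k` coordinates passes to the first `k + 1` if the conditional law of
the next one is dominated. -/
theorem integral_prod_le (hiid : E.CanonicalIID) {k : ℕ} {ρ : Measure (Fin k → ℝ)}
    [IsProbabilityMeasure ρ]
    (hρ : ∀ φ : (Fin k → ℝ) →ᵇ ℝ, (∃ K : ℝ≥0, LipschitzWith K φ) →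
      ∫ y, φ y ∂ρ ≤ E (φ.compContinuous (firstCoords k)))
    {B : Set (Fin k → ℝ)} (hB : MeasurableSet B) {ν₁ ν₂ : Measure ℝ}
    (h₁ : ν₁ ∈ E.marginals) (h₂ : ν₂ ∈ E.marginals) (φ : ((Fin k → ℝ) × ℝ) →ᵇ ℝ)
    (hφ : ∃ K : ℝ≥0, LipschitzWith K φ) :
    ∫ p, φ p ∂((ρ.restrict B).prod ν₁ + (ρ.restrict Bᶜ).prod ν₂) ≤
      E (φ.compContinuous ((firstCoords k).prodMk (coord k))) := by
  obtain ⟨K, hK⟩ := hφ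
  have := h₁.1
  have := h₂.1
  set g := E.partialExp (coord k) φ ⟨K, hK⟩
  have hint : ∀ {ν : Measure ℝ} {B : Set (Fin k → ℝ)}, ν ∈ E.marginals →
      ∫ p, φ p ∂((ρ.restrict B).prod ν) ≤ ∫ y in B, g y ∂ρ := by
    intro ν B hν
    have := hν.1
    have hi := φ.integrable ((ρ.restrict B).prod ν)
    rw [integral_prod _ hi]
    exact integral_mono hi.integral_prod_left (g.integrable _)
      fun y => integral_le_partialExp hiid hν k φ ⟨K, hK⟩ y
  rw [integral_add_measure (φ.integrable _) (φ.integrable _), hiid.1 k φ ⟨K, hK⟩]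
  -- The bounds on `B` and `Bᶜ` have the same integrand `g`, so they reassemble to its integral over
  -- the whole space.
  refine (add_le_add (hint h₁) (hint h₂)).trans ?_
  rw [integral_add_compl hB (g.integrable _)]
  exact hρ g ⟨K, lipschitzWith_partialExp _ _ hK⟩

variable {d : ℕ} {A : ℕ → Set (Fin d → ℝ)} {P : Measure (ℕ → ℝ)} {ν₁ ν₂ : Measure ℝ}
  [IsProbabilityMeasure ν₁] [IsProbabilityMeasure ν₂]

theorem spliceMeasure_mem_Theta (hreg : E.IsRegular) (hiid : E.CanonicalIID)
    (hA : ∀ k, MeasurableSet (A k)) (hP : P ∈ E.Theta)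
    (h₁ : ν₁ ∈ E.marginals) (h₂ : ν₂ ∈ E.marginals) : spliceMeasure A P ν₁ ν₂ ∈ E.Theta := by
  have := hP.1
  have := isProbabilityMeasure_spliceMeasure hA P ν₁ ν₂
  set Q := spliceMeasure A P ν₁ ν₂ with hQ
  refine mem_Theta_of_firstCoords hreg fun k => ?_
  -- Up to time d the law is that of P; beyond d, induction adds one coordinate at a time.
  rcases le_total k d with hk | hk
  · intro φ _
    let χ : (Fin d → ℝ) → ℝ := fun y => φ fun i => y (Fin.castLE hk i)
    have hχ : Continuous χ := by fun_prop
    have hmap : ∀ μ : Measure (ℕ → ℝ),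
        ∫ ω, φ (firstCoords k ω) ∂μ = ∫ y, χ y ∂(μ.map (firstCoords d)) := fun μ => by
      rw [integral_map (measurable_firstCoords d).aemeasurable hχ.aestronglyMeasurable]
      rfl
    rw [hmap, hQ, spliceMeasure_map_firstCoords hA, ← hmap]
    exact hP.2 (φ.compContinuous (firstCoords k))
  · induction k, hk using Nat.le_induction with
    | base =>
      intro φ _
      rw [← integral_map (φ := firstCoords d) (measurable_firstCoords d).aemeasurable
        φ.continuous.aestronglyMeasurable, hQ, spliceMeasure_map_firstCoords hA,
        integral_map (measurable_firstCoords d).aemeasurable φ.continuous.aestronglyMeasurable]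
      exact hP.2 (φ.compContinuous (firstCoords d))
    | succ k hk ih =>
      rintro φ ⟨K, hK⟩
      let φ' : ((Fin k → ℝ) × ℝ) →ᵇ ℝ := φ.compContinuous
        ⟨fun p => (Fin.snoc p.1 p.2 : Fin (k + 1) → ℝ), (lipschitzWith_snoc k).continuous⟩
      have hφ' : LipschitzWith (K * 1) φ' := hK.comp (lipschitzWith_snoc k)
      have hcomp : ∀ ω, φ' (firstCoords k ω, coord k ω) = φ (firstCoords (k + 1) ω) := fun ω =>
        congrArg φ (snoc_firstCoords k ω)
      have hE : φ'.compContinuous ((firstCoords k).prodMk (coord k)) =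
          φ.compContinuous (firstCoords (k + 1)) := by
        ext ω; exact hcomp ω
      have hm : Measurable fun ω => (firstCoords k ω, coord k ω) :=
        (measurable_firstCoords k).prodMk (measurable_coord k)
      have := Measure.isProbabilityMeasure_map (μ := Q) (measurable_firstCoords k).aemeasurable
      calc ∫ ω, φ (firstCoords (k + 1) ω) ∂Q
          = ∫ p, φ' p ∂(Q.map fun ω => (firstCoords k ω, coord k ω)) := by
            rw [integral_map hm.aemeasurable φ'.continuous.aestronglyMeasurable]
            exact integral_congr_ae (Eventually.of_forall fun ω => (hcomp ω).symm)
        _ ≤ E (φ'.compContinuous ((firstCoords k).prodMk (coord k))) := by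
            rw [hQ, spliceMeasure_map_prod hA P ν₁ ν₂ hk, ← hQ]
            refine integral_prod_le hiid (fun χ hχ => ?_) (measurableSet_liftSet hk (hA k)) h₁ h₂
              φ' ⟨_, hφ'⟩
            rw [integral_map (measurable_firstCoords k).aemeasurable
              χ.continuous.aestronglyMeasurable]
            exact ih χ hχ
        _ = E (φ.compContinuous (firstCoords (k + 1))) := by rw [hE]

end SublinearExpectation

/-! ### Conditional laws under members of Θ, and extremality of the spliced measure. -/

theorem measure_ext_of_map_firstCoords {Q₁ Q₂ : Measure (ℕ → ℝ)} [IsFiniteMeasure Q₁] (d : ℕ)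
    (h : ∀ k, d ≤ k → Q₁.map (firstCoords k) = Q₂.map (firstCoords k)) : Q₁ = Q₂ := by
  have hmap : ∀ I : Finset ℕ, Q₁.map I.restrict = Q₂.map I.restrict := by
    intro I
    obtain ⟨n, hn⟩ : ∃ n, I ⊆ Finset.range n := I.exists_nat_subset_range
    have hlt : ∀ i : I, (i : ℕ) < max d n := fun i =>
      (Finset.mem_range.1 (hn i.2)).trans_le (le_max_right _ _)
    let g : (Fin (max d n) → ℝ) → I → ℝ := fun y i => y ⟨i, hlt i⟩
    have hg : Measurable g := by fun_prop
    have hr : (I.restrict : (ℕ → ℝ) → I → ℝ) = g ∘ firstCoords (max d n) := rfl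
    rw [hr, ← Measure.map_map hg (measurable_firstCoords _),
      ← Measure.map_map hg (measurable_firstCoords _), h _ (le_max_left _ _)]
  have : ∀ I : Finset ℕ, IsFiniteMeasure (Q₁.map I.restrict) := fun I => inferInstance
  exact IsProjectiveLimit.unique (P := fun I => Q₁.map I.restrict) (fun I => rfl)
    fun I => (hmap I).symm

namespace SublinearExpectation

variable {E : SublinearExpectation (ℕ → ℝ)}

/-- A weak form of E_Q[ψ(ξ_{k+1}) | 𝓕_k] ≤ 𝔼[ψ(ξ_1)]. By positive homogeneity, which needs χ ≥ 0,
the partial expectation of χ(y)(ψ - c) vanishes, and so does its full expectation under 𝔼. -/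
theorem integral_mul_sub_nonpos (hiid : E.CanonicalIID) {Q : Measure (ℕ → ℝ)} (hQ : Q ∈ E.Theta)
    {k : ℕ} (χ : (Fin k → ℝ) →ᵇ ℝ≥0) (hχ : ∃ K : ℝ≥0, LipschitzWith K χ)
    (ψ : ℝ →ᵇ ℝ) (hψ : ∃ K : ℝ≥0, LipschitzWith K ψ) :
    ∫ ω, (χ (firstCoords k ω) : ℝ) * (ψ (coord k ω) - E (ψ.compContinuous (coord 0))) ∂Q ≤ 0 := by
  obtain ⟨K, hK⟩ := hχ
  obtain ⟨L, hL⟩ := hψ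
  set c := E (ψ.compContinuous (coord 0)) with hc
  obtain ⟨M, hM⟩ : ∃ M : ℝ, ∀ y, (χ y : ℝ) ≤ M := by
    obtain ⟨M, hM⟩ := χ.isBounded_range.bddAbove
    exact ⟨M, fun y => by exact_mod_cast hM ⟨y, rfl⟩⟩
  have hM0 : 0 ≤ M := (χ 0).2.trans (hM 0)
  let C : ℝ := ‖ψ‖ + |c|
  have hC : ∀ x, |ψ x - c| ≤ C := fun x =>
    (abs_sub _ _).trans (add_le_add (ψ.norm_coe_le_norm x) le_rfl)
  have hC0 : 0 ≤ C := by positivity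
  let φ : ((Fin k → ℝ) × ℝ) →ᵇ ℝ := BoundedContinuousFunction.ofNormedAddCommGroup
    (fun p => (χ p.1 : ℝ) * (ψ p.2 - c)) (by fun_prop) (M * C) (fun p => by
      rw [norm_mul, Real.norm_eq_abs, Real.norm_eq_abs, abs_of_nonneg (χ p.1).coe_nonneg]
      exact mul_le_mul (hM _) (hC _) (abs_nonneg _) hM0)
  have hφ : LipschitzWith (C.toNNReal * K + M.toNNReal * L) φ := by
    refine LipschitzWith.of_dist_le_mul fun p q => ?_
    change dist ((χ p.1 : ℝ) * (ψ p.2 - c)) ((χ q.1 : ℝ) * (ψ q.2 - c)) ≤ _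
    have h1 : |(χ p.1 : ℝ) - χ q.1| ≤ K * dist p q :=
      (hK.dist_le_mul p.1 q.1).trans (mul_le_mul_of_nonneg_left (le_max_left _ _) K.2)
    have h2 : |ψ p.2 - ψ q.2| ≤ L * dist p q :=
      (hL.dist_le_mul p.2 q.2).trans (mul_le_mul_of_nonneg_left (le_max_right _ _) L.2)
    have heq : (χ p.1 : ℝ) * (ψ p.2 - c) - χ q.1 * (ψ q.2 - c) =
        (ψ p.2 - c) * ((χ p.1 : ℝ) - χ q.1) + χ q.1 * (ψ p.2 - ψ q.2) := by ring
    rw [Real.dist_eq, heq]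
    push_cast
    rw [Real.coe_toNNReal _ hC0, Real.coe_toNNReal _ hM0]
    refine (abs_add_le _ _).trans ?_
    rw [abs_mul, abs_mul, abs_of_nonneg (χ q.1).coe_nonneg]
    have h3 := mul_le_mul (hC p.2) h1 (abs_nonneg _) hC0
    have h4 := mul_le_mul (hM q.1) h2 (abs_nonneg _) hM0
    linarith
  have hpart : E.partialExp (coord k) φ ⟨_, hφ⟩ = 0 := by
    ext y
    change E (frozen (coord k) φ y) = 0
    let ψ' : ℝ →ᵇ ℝ := ψ - BoundedContinuousFunction.const ℝ c
    have hf : frozen (coord k) φ y = (χ y : ℝ) • ψ'.compContinuous (coord k) := by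
      ext ω; rfl
    have hψ' : LipschitzWith L ψ' := by
      refine LipschitzWith.of_dist_le_mul fun x y => ?_
      have := hL.dist_le_mul x y
      simpa [ψ'] using this
    have h0 : E (ψ'.compContinuous (coord 0)) = 0 := by
      apply le_antisymm
      · have := E.le_add_of_forall_le (X := ψ'.compContinuous (coord 0))
          (Y := ψ.compContinuous (coord 0)) (c := -c) fun ω => by simp [ψ', sub_eq_add_neg]
        linarith
      · have := E.le_add_of_forall_le (X := ψ.compContinuous (coord 0))
          (Y := ψ'.compContinuous (coord 0)) (c := c) fun ω => by simp [ψ']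
        linarith
    rw [hf, E.pos_homog' _ _ (χ y).coe_nonneg, hiid.apply_coord k ψ' ⟨L, hψ'⟩, h0, mul_zero]
  have h := hQ.2 (φ.compContinuous ((firstCoords k).prodMk (coord k)))
  rw [hiid.1 k φ ⟨_, hφ⟩, hpart] at h
  have hz : E ((0 : (Fin k → ℝ) →ᵇ ℝ).compContinuous (firstCoords k)) = 0 := E.map_const' 0
  rw [hz] at h
  exact h

/-- Thickened indicators are Lipschitz weights converging to the indicator of a closed set;
measurable sets follow by inner approximation. -/
theorem setIntegral_sub_nonpos (hiid : E.CanonicalIID) {Q : Measure (ℕ → ℝ)} (hQ : Q ∈ E.Theta)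
    {k : ℕ} {s : Set (Fin k → ℝ)} (hs : MeasurableSet s) (ψ : ℝ →ᵇ ℝ)
    (hψ : ∃ K : ℝ≥0, LipschitzWith K ψ) :
    ∫ ω in firstCoords k ⁻¹' s, (ψ (coord k ω) - E (ψ.compContinuous (coord 0))) ∂Q ≤ 0 := by
  have := hQ.1
  set c := E (ψ.compContinuous (coord 0)) with hc
  let C : ℝ := ‖ψ‖ + |c|
  have hC : ∀ x, |ψ x - c| ≤ C := fun x =>
    (abs_sub _ _).trans (add_le_add (ψ.norm_coe_le_norm x) le_rfl)
  have hC0 : 0 ≤ C := by positivity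
  have hm := measurable_firstCoords k
  have hmeas : Measurable fun ω => ψ (coord k ω) - c :=
    (ψ.continuous.measurable.comp (measurable_coord k)).sub_const c
  have hint : Integrable (fun ω => ψ (coord k ω) - c) Q :=
    Integrable.of_bound hmeas.aestronglyMeasurable C (Eventually.of_forall fun ω => hC _)
  have hclosed : ∀ F : Set (Fin k → ℝ), IsClosed F →
      ∫ ω in firstCoords k ⁻¹' F, (ψ (coord k ω) - c) ∂Q ≤ 0 := by
    intro F hF
    have hpos : ∀ n : ℕ, (0 : ℝ) < 1 / ((n : ℝ) + 1) := fun n => Nat.one_div_pos_of_nat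
    have hlim := tendsto_pi_nhds.1 (thickenedIndicator_tendsto_indicator_closure hpos
      tendsto_one_div_add_atTop_nhds_zero_nat F)
    rw [hF.closure_eq] at hlim
    rw [← integral_indicator (hm hF.measurableSet)]
    refine le_of_tendsto' (tendsto_integral_of_dominated_convergence
      (F := fun n ω => (thickenedIndicator (hpos n) F (firstCoords k ω) : ℝ) * (ψ (coord k ω) - c))
      (fun _ => C) (fun n => ?_) (integrable_const C) (fun n => ?_) ?_) fun n =>
      integral_mul_sub_nonpos hiid hQ (thickenedIndicator (hpos n) F)
        ⟨_, lipschitzWith_thickenedIndicator (hpos n) F⟩ ψ hψ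
    · refine Measurable.aestronglyMeasurable ?_
      refine Measurable.mul ?_ hmeas
      exact ((thickenedIndicator (hpos n) F).continuous.measurable.comp hm).coe_nnreal_real
    · refine Eventually.of_forall fun ω => ?_
      have h1 : (thickenedIndicator (hpos n) F (firstCoords k ω) : ℝ) ≤ 1 := by
        exact_mod_cast thickenedIndicator_le_one (hpos n) F _
      rw [norm_mul, Real.norm_eq_abs, Real.norm_eq_abs, abs_of_nonneg (NNReal.coe_nonneg _)]
      calc _ ≤ 1 * C := mul_le_mul h1 (hC _) (abs_nonneg _) zero_le_one
        _ = C := one_mul C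
    · refine Eventually.of_forall fun ω => ?_
      have h1 := (NNReal.tendsto_coe.2 (hlim (firstCoords k ω))).mul_const (ψ (coord k ω) - c)
      convert h1 using 2
      by_cases hω : firstCoords k ω ∈ F <;> simp [Set.indicator, hω]
  refine le_of_forall_pos_le_add fun ε hε => ?_
  rw [zero_add]
  have := Measure.isProbabilityMeasure_map (μ := Q) hm.aemeasurable
  -- The integrand is at most `C` in absolute value, so the remainder contributes at most `C * (ε /
  -- (C + 1)) ≤ ε`; the added 1 covers `C = 0`.
  obtain ⟨F, hFs, hF, hlt⟩ := hs.exists_isClosed_sdiff_lt (μ := Q.map (firstCoords k))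
    (measure_ne_top _ _) (ε := ENNReal.ofReal (ε / (C + 1)))
    (by rw [Ne, ENNReal.ofReal_eq_zero, not_le]; positivity)
  have hsF : MeasurableSet (s \ F) := hs.diff hF.measurableSet
  rw [Measure.map_apply hm hsF] at hlt
  have hsplit : firstCoords k ⁻¹' s = firstCoords k ⁻¹' F ∪ firstCoords k ⁻¹' (s \ F) := by
    rw [← Set.preimage_union, Set.union_sdiff_cancel hFs]
  have hdisj : Disjoint (firstCoords k ⁻¹' F) (firstCoords k ⁻¹' (s \ F)) :=
    Disjoint.preimage _ Set.disjoint_sdiff_right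
  rw [hsplit, setIntegral_union hdisj (hm hsF) hint.integrableOn hint.integrableOn]
  have hb : ∫ ω in firstCoords k ⁻¹' (s \ F), (ψ (coord k ω) - c) ∂Q ≤ ε := by
    refine (le_abs_self _).trans ?_
    have h1 := norm_setIntegral_le_of_norm_le_const (μ := Q) (measure_lt_top Q _)
      (s := firstCoords k ⁻¹' (s \ F)) (f := fun ω => ψ (coord k ω) - c) (C := C)
      fun ω _ => hC _
    refine h1.trans ?_
    have h2 : Q.real (firstCoords k ⁻¹' (s \ F)) ≤ ε / (C + 1) :=
      ENNReal.toReal_le_of_le_ofReal (by positivity) hlt.le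
    calc C * Q.real (firstCoords k ⁻¹' (s \ F)) ≤ C * (ε / (C + 1)) :=
          mul_le_mul_of_nonneg_left h2 hC0
      _ ≤ (C + 1) * (ε / (C + 1)) := by gcongr; linarith
      _ = ε := by field_simp
  linarith [hclosed F hF]

theorem smul_map_coord_mem_marginals (hiid : E.CanonicalIID) {Q : Measure (ℕ → ℝ)}
    (hQ : Q ∈ E.Theta) {k : ℕ} {s : Set (Fin k → ℝ)} (hs : MeasurableSet s) {q : ℝ≥0}
    (hq : Q (firstCoords k ⁻¹' s) = q) (hq0 : q ≠ 0) :
    q⁻¹ • (Q.restrict (firstCoords k ⁻¹' s)).map (coord k) ∈ E.marginals := by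
  have := hQ.1
  have hc := measurable_coord k
  refine ⟨⟨?_⟩, fun ψ hψ => ?_⟩
  · rw [Measure.smul_apply, Measure.map_apply hc .univ, Set.preimage_univ,
      Measure.restrict_apply_univ, hq, ENNReal.smul_def, smul_eq_mul, ← ENNReal.coe_mul,
      inv_mul_cancel₀ hq0, ENNReal.coe_one]
  · have h := setIntegral_sub_nonpos hiid hQ hs ψ hψ
    have hi : Integrable (fun ω => ψ (coord k ω)) (Q.restrict (firstCoords k ⁻¹' s)) :=
      (ψ.compContinuous (coord k)).integrable _
    rw [integral_sub hi (integrable_const _), integral_const, measureReal_restrict_apply_univ,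
      Measure.real, hq, ENNReal.coe_toReal, smul_eq_mul, sub_nonpos] at h
    rw [integral_smul_nnreal_measure, integral_map hc.aemeasurable
      ψ.continuous.aestronglyMeasurable, NNReal.smul_def, smul_eq_mul, NNReal.coe_inv,
      inv_mul_le_iff₀ (by positivity)]
    exact h

/-- As `Q₁`, `Q₂` and `Q` give the past event the same mass, conditioning on it preserves the convex
combination. The conditional laws of the next coordinate then average to the extreme point `ν`.
Segments use ℝ≥0 scalars, which act on measures. -/
theorem measure_inter_eq_of_extremePoints (hiid : E.CanonicalIID) {Q Q₁ Q₂ : Measure (ℕ → ℝ)}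
    (h₁ : Q₁ ∈ E.Theta) (h₂ : Q₂ ∈ E.Theta) (hQ : Q ∈ openSegment ℝ≥0 Q₁ Q₂) {k : ℕ}
    {s : Set (Fin k → ℝ)} (hs : MeasurableSet s)
    (hs₁ : Q₁ (firstCoords k ⁻¹' s) = Q (firstCoords k ⁻¹' s))
    (hs₂ : Q₂ (firstCoords k ⁻¹' s) = Q (firstCoords k ⁻¹' s))
    {ν : Measure ℝ} (hν : ν ∈ Set.extremePoints ℝ≥0 E.marginals)
    (hprod : ∀ t, MeasurableSet t →
      Q (firstCoords k ⁻¹' s ∩ coord k ⁻¹' t) = Q (firstCoords k ⁻¹' s) * ν t)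
    {t : Set ℝ} (ht : MeasurableSet t) :
    Q₁ (firstCoords k ⁻¹' s ∩ coord k ⁻¹' t) = Q (firstCoords k ⁻¹' s) * ν t := by
  have := h₁.1
  have := h₂.1
  have hc := measurable_coord k
  obtain ⟨q, hq⟩ : ∃ q : ℝ≥0, Q (firstCoords k ⁻¹' s) = q :=
    ⟨_, (ENNReal.coe_toNNReal (hs₁ ▸ measure_ne_top Q₁ _)).symm⟩
  rw [hq] at hs₁ hs₂ hprod ⊢
  rcases eq_or_ne q 0 with rfl | hq0
  · simp only [ENNReal.coe_zero, zero_mul] at hs₁ ⊢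
    exact measure_mono_null Set.inter_subset_left hs₁
  obtain ⟨a, b, ha, hb, hab, rfl⟩ := hQ
  have hmap : ∀ (R : Measure (ℕ → ℝ)) {t : Set ℝ}, MeasurableSet t →
      (R.restrict (firstCoords k ⁻¹' s)).map (coord k) t =
        R (firstCoords k ⁻¹' s ∩ coord k ⁻¹' t) := fun R t ht => by
    rw [Measure.map_apply hc ht, Measure.restrict_apply (hc ht), Set.inter_comm]
  have hcancel : ∀ x : ℝ≥0∞, ((q⁻¹ : ℝ≥0) : ℝ≥0∞) * (q * x) = x := fun x => by
    rw [← mul_assoc, ← ENNReal.coe_mul, inv_mul_cancel₀ hq0, ENNReal.coe_one, one_mul]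
  have heq := hν.2 (smul_map_coord_mem_marginals hiid h₁ hs hs₁ hq0)
    (smul_map_coord_mem_marginals hiid h₂ hs hs₂ hq0) ⟨a, b, ha, hb, hab, by
      ext t ht
      have h := hprod t ht
      simp only [Measure.add_apply, Measure.smul_apply, ENNReal.smul_def, smul_eq_mul] at h
      simp only [Measure.add_apply, Measure.smul_apply, ENNReal.smul_def, smul_eq_mul, hmap _ ht]
      rw [← hcancel (ν t), ← h]
      ring⟩
  have h := congrArg (fun μ : Measure ℝ => (q : ℝ≥0∞) * μ t) heq
  simp only [Measure.smul_apply, ENNReal.smul_def, smul_eq_mul, hmap _ ht] at h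
  rw [← h, ← mul_assoc, ← ENNReal.coe_mul, mul_inv_cancel₀ hq0, ENNReal.coe_one, one_mul]

end SublinearExpectation

namespace SublinearExpectation

variable {E : SublinearExpectation (ℕ → ℝ)} {d : ℕ} {A : ℕ → Set (Fin d → ℝ)}
  {P : Measure (ℕ → ℝ)} {ν₁ ν₂ : Measure ℝ} [IsProbabilityMeasure ν₁] [IsProbabilityMeasure ν₂]

theorem map_eq_of_mem_extremePoints_Xi {Q Q₁ Q₂ : Measure (ℕ → ℝ)} {k : ℕ}
    (hQ : Q.map (firstCoords k) ∈ Set.extremePoints ℝ≥0 (E.Xi k))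
    (h₁ : Q₁ ∈ E.Theta) (h₂ : Q₂ ∈ E.Theta) (h : Q ∈ openSegment ℝ≥0 Q₁ Q₂) :
    Q₁.map (firstCoords k) = Q.map (firstCoords k) := by
  obtain ⟨a, b, ha, hb, hab, rfl⟩ := h
  have hm := measurable_firstCoords k
  refine hQ.2 ⟨Q₁, h₁, rfl⟩ ⟨Q₂, h₂, rfl⟩ ⟨a, b, ha, hb, hab, ?_⟩
  rw [Measure.map_add _ _ hm, Measure.map_smul, Measure.map_smul]

theorem spliceMeasure_inter (hA : ∀ k, MeasurableSet (A k)) [IsProbabilityMeasure P] {k : ℕ}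
    (h : d ≤ k) {s : Set (Fin k → ℝ)} (hs : MeasurableSet s) {t : Set ℝ} (ht : MeasurableSet t) :
    spliceMeasure A P ν₁ ν₂ (firstCoords k ⁻¹' s ∩ coord k ⁻¹' t) =
      spliceMeasure A P ν₁ ν₂ (firstCoords k ⁻¹' (s ∩ liftSet h (A k))) * ν₁ t +
      spliceMeasure A P ν₁ ν₂ (firstCoords k ⁻¹' (s ∩ (liftSet h (A k))ᶜ)) * ν₂ t := by
  have hm := measurable_firstCoords k
  have hB := measurableSet_liftSet h (hA k)
  have := isProbabilityMeasure_spliceMeasure hA P ν₁ ν₂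
  have := Measure.isProbabilityMeasure_map (μ := spliceMeasure A P ν₁ ν₂) hm.aemeasurable
  have hpair : Measurable fun ω => (firstCoords k ω, coord k ω) := hm.prodMk (measurable_coord k)
  have heq := congrArg (fun μ => μ (s ×ˢ t)) (spliceMeasure_map_prod hA P ν₁ ν₂ h)
  simp only [Measure.map_apply hpair (hs.prod ht), Measure.add_apply, Measure.prod_prod,
    Measure.restrict_apply hs, Measure.map_apply hm (hs.inter hB),
    Measure.map_apply hm (hs.inter hB.compl)] at heq
  exact heq

/-- Extremality in `Xi` settles the first d coordinates; extremality of `ν₁` and `ν₂` then settles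
each further one. -/
theorem spliceMeasure_mem_extremePoints (hreg : E.IsRegular) (hiid : E.CanonicalIID)
    (hA : ∀ k, MeasurableSet (A k)) (hP : P ∈ E.Theta)
    (hPd : P.map (firstCoords d) ∈ Set.extremePoints ℝ≥0 (E.Xi d))
    (h₁ : ν₁ ∈ Set.extremePoints ℝ≥0 E.marginals)
    (h₂ : ν₂ ∈ Set.extremePoints ℝ≥0 E.marginals) :
    spliceMeasure A P ν₁ ν₂ ∈ Set.extremePoints ℝ≥0 E.Theta := by
  have := hP.1
  refine ⟨spliceMeasure_mem_Theta hreg hiid hA hP h₁.1 h₂.1, fun Q₁ hQ₁ Q₂ hQ₂ hQ => ?_⟩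
  have hinter := fun {k} => spliceMeasure_inter (P := P) (ν₁ := ν₁) (ν₂ := ν₂) hA (k := k)
  have hmapd := spliceMeasure_map_firstCoords hA P ν₁ ν₂
  have := isProbabilityMeasure_spliceMeasure hA P ν₁ ν₂
  set Q := spliceMeasure A P ν₁ ν₂
  rw [← hmapd] at hPd
  have hQ' : Q ∈ openSegment ℝ≥0 Q₂ Q₁ := by rwa [openSegment_symm]
  have := hQ₁.1
  have := hQ₂.1
  -- Each step needs agreement of both components at level k, so it is stated symmetrically and used
  -- for both orders.
  have step : ∀ {k : ℕ}, d ≤ k → ∀ {R R' : Measure (ℕ → ℝ)}, R ∈ E.Theta → R' ∈ E.Theta →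
      Q ∈ openSegment ℝ≥0 R R' → R.map (firstCoords k) = Q.map (firstCoords k) →
      R'.map (firstCoords k) = Q.map (firstCoords k) →
      R.map (firstCoords (k + 1)) = Q.map (firstCoords (k + 1)) := by
    intro k hk R R' hR hR' hseg hRk hRk'
    have := hR.1
    have hm := measurable_firstCoords k
    have hc := measurable_coord k
    have hB := measurableSet_liftSet hk (hA k)
    have hpre : ∀ {S : Measure (ℕ → ℝ)}, S.map (firstCoords k) = Q.map (firstCoords k) →
        ∀ s, MeasurableSet s → S (firstCoords k ⁻¹' s) = Q (firstCoords k ⁻¹' s) := by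
      intro S hS s hs
      rw [← Measure.map_apply hm hs, hS, Measure.map_apply hm hs]
    have hpair : Measurable fun ω => (firstCoords k ω, coord k ω) := hm.prodMk hc
    have hsnoc : Measurable fun p : (Fin k → ℝ) × ℝ => (Fin.snoc p.1 p.2 : Fin (k + 1) → ℝ) :=
      (lipschitzWith_snoc k).continuous.measurable
    have hcomp : ⇑(firstCoords (k + 1)) =
        (fun p : (Fin k → ℝ) × ℝ => (Fin.snoc p.1 p.2 : Fin (k + 1) → ℝ)) ∘
          fun ω => (firstCoords k ω, coord k ω) := by
      ext1 ω; exact (snoc_firstCoords k ω).symm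
    rw [hcomp, ← Measure.map_map hsnoc hpair, ← Measure.map_map hsnoc hpair]
    congr 1
    have := Measure.isProbabilityMeasure_map (μ := R) hpair.aemeasurable
    refine Measure.ext_prod fun {s} {t} hs ht => ?_
    rw [Measure.map_apply hpair (hs.prod ht), Measure.map_apply hpair (hs.prod ht)]
    change R (firstCoords k ⁻¹' s ∩ coord k ⁻¹' t) = Q (firstCoords k ⁻¹' s ∩ coord k ⁻¹' t)
    set B := liftSet hk (A k) with hBdef
    have hsB := hs.inter hB
    have hsB' := hs.inter hB.compl
    have e1 : s ∩ B ∩ B = s ∩ B := by rw [Set.inter_assoc, Set.inter_self]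
    have e2 : s ∩ B ∩ Bᶜ = ∅ := by rw [Set.inter_assoc, Set.inter_compl_self, Set.inter_empty]
    have e3 : s ∩ Bᶜ ∩ B = ∅ := by rw [Set.inter_assoc, Set.compl_inter_self, Set.inter_empty]
    have e4 : s ∩ Bᶜ ∩ Bᶜ = s ∩ Bᶜ := by rw [Set.inter_assoc, Set.inter_self]
    -- Within `s ∩ B` only `ν₁` is drawn, within `s ∩ Bᶜ` only `ν₂`, so the next coordinate is
    -- independent of the past there.
    have hR1 := measure_inter_eq_of_extremePoints hiid hR hR' hseg hsB (hpre hRk _ hsB)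
      (hpre hRk' _ hsB) h₁ (fun t ht => by
        rw [hinter hk hsB ht, ← hBdef, e1, e2]; simp) ht
    have hR2 := measure_inter_eq_of_extremePoints hiid hR hR' hseg hsB' (hpre hRk _ hsB')
      (hpre hRk' _ hsB') h₂ (fun t ht => by
        rw [hinter hk hsB' ht, ← hBdef, e3, e4]; simp) ht
    rw [hinter hk hs ht, ← hR1, ← hR2,
      ← measure_inter_add_sdiff (μ := R) (firstCoords k ⁻¹' s ∩ coord k ⁻¹' t) (hm hB)]
    congr 2 <;> · ext ω; simp only [Set.mem_inter_iff, Set.mem_preimage, Set.mem_sdiff,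
                    Set.mem_compl_iff]; tauto
  have key : ∀ k, d ≤ k → Q₁.map (firstCoords k) = Q.map (firstCoords k) ∧
      Q₂.map (firstCoords k) = Q.map (firstCoords k) := by
    intro k hk
    induction k, hk using Nat.le_induction with
    | base =>
      exact ⟨map_eq_of_mem_extremePoints_Xi hPd hQ₁ hQ₂ hQ,
        map_eq_of_mem_extremePoints_Xi hPd hQ₂ hQ₁ hQ'⟩
    | succ k hk ih =>
      exact ⟨step hk hQ₁ hQ₂ hQ ih.1 ih.2, step hk hQ₂ hQ₁ hQ' ih.2 ih.1⟩
  exact measure_ext_of_map_firstCoords d fun k hk => (key k hk).1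

end SublinearExpectation

/-! ### Moment bounds, compactness, and extreme marginals of extremal mean. -/

/-- The `γ`-th absolute moments of the elements of a set of measures on `ℝ` are at most `C`. -/
def MomentBound (S : Set (Measure ℝ)) (γ C : ℝ) : Prop :=
  ∀ ν ∈ S, Integrable (fun x => |x| ^ γ) ν ∧ ∫ x, |x| ^ γ ∂ν ≤ C

namespace SublinearExpectation

variable {E : SublinearExpectation (ℕ → ℝ)}

/-- To realize `ν`, splice with d = 0 and `ν` in both slots: the i.i.d. law is in Θ. -/
theorem mem_marginals_iff (hreg : E.IsRegular) (hiid : E.CanonicalIID) (hne : E.Theta.Nonempty)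
    {ν : Measure ℝ} : ν ∈ E.marginals ↔ ∃ P ∈ E.Theta, P.map (coord 0) = ν := by
  refine ⟨fun hν => ?_, fun ⟨P, hP, h⟩ => h ▸ map_coord_mem_marginals hP⟩
  obtain ⟨P, hP⟩ := hne
  have := hP.1
  have := hν.1
  have hA : ∀ _ : ℕ, MeasurableSet (Set.univ : Set (Fin 0 → ℝ)) := fun _ => .univ
  have := isProbabilityMeasure_spliceMeasure hA P ν ν
  refine ⟨_, spliceMeasure_mem_Theta hreg hiid hA hP hν hν, ?_⟩
  ext t ht
  rw [Measure.map_apply (measurable_coord 0) ht]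
  have h := spliceMeasure_inter (P := P) (ν₁ := ν) (ν₂ := ν) hA le_rfl .univ ht
  have hu : liftSet le_rfl (Set.univ : Set (Fin 0 → ℝ)) = Set.univ := rfl
  simpa [hu] using h

/-- A bounded `g` at `L^γ` distance below 1 and convexity of the γ-th power give a bound uniform
over Θ. -/
theorem exists_moment_bound {γ : ℝ} (hγ : 1 < γ) (hL : E.MemLpE γ (coord 0)) :
    ∃ C : ℝ≥0, ∀ P ∈ E.Theta, ∫⁻ ω, ‖coord 0 ω‖ₑ ^ γ ∂P ≤ C := by
  have hγ0 : 0 < γ := by linarith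
  obtain ⟨g, hg⟩ := hL.2 1 one_pos
  have hsup : (⨆ P ∈ E.Theta, ∫⁻ ω, ‖coord 0 ω - g ω‖ₑ ^ γ ∂P) ≤ 1 := by
    by_contra! h
    exact absurd hg (not_lt.2 (ENNReal.one_lt_rpow h (by positivity)).le)
  let C : ℝ≥0∞ := 2 ^ (γ - 1) * (1 + ‖g‖ₑ ^ γ)
  have hC : C ≠ ∞ := ENNReal.mul_ne_top (ENNReal.rpow_ne_top_of_nonneg (by linarith) (by simp))
    (ENNReal.add_ne_top.2 ⟨by simp, ENNReal.rpow_ne_top_of_nonneg hγ0.le (by simp)⟩)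
  refine ⟨C.toNNReal, fun P hP => ?_⟩
  rw [ENNReal.coe_toNNReal hC]
  have := hP.1
  have h1 : ∫⁻ ω, ‖coord 0 ω - g ω‖ₑ ^ γ ∂P ≤ 1 :=
    (le_iSup₂ (f := fun P _ => ∫⁻ ω, ‖coord 0 ω - g ω‖ₑ ^ γ ∂P) P hP).trans hsup
  have hmeas : Measurable fun ω => ‖coord 0 ω - g ω‖ₑ ^ γ :=
    ((measurable_coord 0).sub g.continuous.measurable).enorm.pow_const γ
  calc ∫⁻ ω, ‖coord 0 ω‖ₑ ^ γ ∂P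
      ≤ ∫⁻ ω, 2 ^ (γ - 1) * (‖coord 0 ω - g ω‖ₑ ^ γ + ‖g‖ₑ ^ γ) ∂P := by
        refine lintegral_mono fun ω => ?_
        have h2 : ‖coord 0 ω‖ₑ ≤ ‖coord 0 ω - g ω‖ₑ + ‖g‖ₑ := by
          have h3 : ‖coord 0 ω‖ₑ ≤ ‖coord 0 ω - g ω‖ₑ + ‖g ω‖ₑ := by
            simpa using enorm_add_le (coord 0 ω - g ω) (g ω)
          refine h3.trans (add_le_add le_rfl ?_)
          exact enorm_le_iff_norm_le.2 (g.norm_coe_le_norm ω)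
        exact (ENNReal.rpow_le_rpow h2 hγ0.le).trans
          (ENNReal.rpow_add_le_mul_rpow_add_rpow _ _ hγ.le)
    _ = 2 ^ (γ - 1) * (∫⁻ ω, ‖coord 0 ω - g ω‖ₑ ^ γ ∂P + ‖g‖ₑ ^ γ) := by
        rw [lintegral_const_mul _ (hmeas.add_const _), lintegral_add_left hmeas, lintegral_const]
        simp
    _ ≤ 2 ^ (γ - 1) * (1 + ‖g‖ₑ ^ γ) := by gcongr

theorem exists_momentBound_marginals (hreg : E.IsRegular) (hiid : E.CanonicalIID)
    (hne : E.Theta.Nonempty) {γ : ℝ} (hγ : 1 < γ) (hL : E.MemLpE γ (coord 0)) :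
    ∃ C, MomentBound E.marginals γ C := by
  obtain ⟨C, hC⟩ := exists_moment_bound hγ hL
  have hγ0 : 0 ≤ γ := by linarith
  have hmeas : Measurable fun x : ℝ => |x| ^ γ := by fun_prop
  refine ⟨C, fun ν hν => ?_⟩
  have hle : ∫⁻ x, ENNReal.ofReal (|x| ^ γ) ∂ν ≤ C := by
    obtain ⟨P, hP, rfl⟩ := (mem_marginals_iff hreg hiid hne).1 hν
    rw [lintegral_map hmeas.ennreal_ofReal (measurable_coord 0)]
    refine le_trans (le_of_eq (lintegral_congr fun ω => ?_)) (hC P hP)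
    rw [← ENNReal.ofReal_rpow_of_nonneg (abs_nonneg _) hγ0, Real.enorm_eq_ofReal_abs]
  have hnn : ∀ x : ℝ, 0 ≤ |x| ^ γ := fun x => Real.rpow_nonneg (abs_nonneg x) γ
  refine ⟨⟨hmeas.aestronglyMeasurable, ?_⟩, ?_⟩
  · rw [hasFiniteIntegral_iff_ofReal (Eventually.of_forall hnn)]
    exact hle.trans_lt ENNReal.coe_lt_top
  · rw [integral_eq_lintegral_of_nonneg_ae (Eventually.of_forall hnn) hmeas.aestronglyMeasurable]
    exact ENNReal.toReal_le_coe_of_le_coe hle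

end SublinearExpectation

section MomentBound

variable {S : Set (Measure ℝ)} {γ C : ℝ}

theorem abs_le_one_add_rpow (hγ : 1 < γ) (x : ℝ) : |x| ≤ 1 + |x| ^ γ := by
  have h0 : 0 ≤ |x| ^ γ := Real.rpow_nonneg (abs_nonneg x) γ
  rcases le_total |x| 1 with h | h
  · linarith
  · have := Real.rpow_le_rpow_of_exponent_le h hγ.le
    rw [Real.rpow_one] at this
    linarith

theorem MomentBound.integrable (h : MomentBound S γ C) (hγ : 1 < γ) {ν : Measure ℝ} (hν : ν ∈ S)
    [IsFiniteMeasure ν] : Integrable (fun x => x) ν :=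
  ((integrable_const 1).add (h ν hν).1).mono' measurable_id.aestronglyMeasurable
    (Eventually.of_forall fun x => abs_le_one_add_rpow hγ x)

/-- Markov's inequality for the first absolute moment, which is at most `1 + C`. -/
theorem MomentBound.isTightMeasureSet (h : MomentBound S γ C) (hγ : 1 < γ)
    (hS : ∀ ν ∈ S, IsProbabilityMeasure ν) : IsTightMeasureSet S := by
  refine isTightMeasureSet_of_tendsto_measure_norm_gt ?_
  have hlim : Tendsto (fun r : ℝ => ENNReal.ofReal ((1 + C) / r)) atTop (𝓝 0) := by
    rw [← ENNReal.ofReal_zero]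
    exact ENNReal.tendsto_ofReal (tendsto_const_nhds.div_atTop tendsto_id)
  refine tendsto_of_tendsto_of_tendsto_of_le_of_le' tendsto_const_nhds hlim
    (Eventually.of_forall fun _ => zero_le) ?_
  filter_upwards [eventually_gt_atTop 0] with r hr
  refine iSup₂_le fun ν hν => ?_
  have := hS ν hν
  have hi := h.integrable hγ hν
  have h1 := mul_meas_ge_le_integral_of_nonneg (μ := ν) (f := fun x => |x|)
    (Eventually.of_forall fun x => abs_nonneg x) hi.abs r
  have h2 : ∫ x, |x| ∂ν ≤ 1 + C := by
    calc ∫ x, |x| ∂ν ≤ ∫ x, (1 + |x| ^ γ) ∂ν :=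
          integral_mono hi.abs ((integrable_const 1).add (h ν hν).1)
            fun x => abs_le_one_add_rpow hγ x
      _ = 1 + ∫ x, |x| ^ γ ∂ν := by
          rw [integral_add (integrable_const 1) (h ν hν).1]; simp
      _ ≤ 1 + C := by linarith [(h ν hν).2]
  refine (measure_mono (t := {x | r ≤ |x|}) fun x hx =>
    le_of_lt (show r < |x| from hx)).trans ?_
  rw [← ENNReal.ofReal_toReal (measure_ne_top ν {x | r ≤ |x|})]
  refine ENNReal.ofReal_le_ofReal ?_
  rw [le_div_iff₀ hr, mul_comm]
  exact h1.trans h2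

/-- The truncation of a real number at the levels `-M` and `M`, for `M = n + 1`. -/
noncomputable def clampBCF (n : ℕ) : ℝ →ᵇ ℝ :=
  BoundedContinuousFunction.ofNormedAddCommGroup (fun x => max (-(n + 1 : ℝ)) (min x (n + 1)))
    (by fun_prop) (n + 1) fun x => by
      have : (0 : ℝ) ≤ n := n.cast_nonneg
      exact abs_le.2 ⟨le_max_left _ _, max_le (by linarith) (min_le_right _ _)⟩

theorem abs_sub_clampBCF_le (hγ : 1 < γ) (n : ℕ) (x : ℝ) :
    |x - clampBCF n x| ≤ ((n : ℝ) + 1) ^ (1 - γ) * |x| ^ γ := by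
  have hn : (0 : ℝ) < n + 1 := by positivity
  change |x - max (-(n + 1 : ℝ)) (min x (n + 1))| ≤ _
  rcases le_or_gt |x| (n + 1) with h | h
  · obtain ⟨h1, h2⟩ := abs_le.1 h
    rw [min_eq_left h2, max_eq_right h1, sub_self, abs_zero]
    positivity
  · have h1 : |x - max (-(n + 1 : ℝ)) (min x (n + 1))| ≤ |x| := by
      rcases lt_abs.1 h with h | h
      · rw [min_eq_right h.le, max_eq_right (by linarith), abs_of_pos (by linarith),
          abs_of_pos (by linarith)]
        linarith
      · rw [min_eq_left (by linarith), max_eq_left (by linarith), abs_of_neg (by linarith),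
          abs_of_neg (by linarith)]
        linarith
    have hx : 0 < |x| := hn.trans h
    calc _ ≤ |x| := h1
      _ = |x| ^ (1 - γ) * |x| ^ γ := by rw [← Real.rpow_add hx]; simp
      _ ≤ _ := by
        gcongr ?_ * _
        exact Real.rpow_le_rpow_of_nonpos hn h.le (by linarith)

/-- Truncated means are weakly continuous and, since γ > 1, converge to the mean uniformly on `S`.
-/
theorem MomentBound.continuousOn_integral (h : MomentBound S γ C) (hγ : 1 < γ) :
    ContinuousOn (fun μ : ProbabilityMeasure ℝ => ∫ x, x ∂(μ : Measure ℝ))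
      {μ | (μ : Measure ℝ) ∈ S} := by
  have hlim : Tendsto (fun n : ℕ => ((n : ℝ) + 1) ^ (1 - γ) * C) atTop (𝓝 0) := by
    have h1 : Tendsto (fun n : ℕ => ((n : ℝ) + 1)) atTop atTop :=
      tendsto_atTop_add_const_right _ _ tendsto_natCast_atTop_atTop
    have h2 := ((tendsto_rpow_neg_atTop (y := γ - 1) (by linarith)).comp h1).mul_const C
    rw [zero_mul] at h2
    simpa [Function.comp_def] using h2
  have hunif : TendstoUniformlyOn
      (fun (n : ℕ) (μ : ProbabilityMeasure ℝ) => ∫ x, clampBCF n x ∂(μ : Measure ℝ))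
      (fun μ => ∫ x, x ∂(μ : Measure ℝ)) atTop {μ | (μ : Measure ℝ) ∈ S} := by
    refine Metric.tendstoUniformlyOn_iff.2 fun ε hε => ?_
    filter_upwards [hlim.eventually (gt_mem_nhds hε)] with n hn μ hμ
    refine lt_of_le_of_lt ?_ hn
    have hi := h.integrable hγ hμ
    have hc := (clampBCF n).integrable (μ : Measure ℝ)
    rw [Real.dist_eq, ← integral_sub hi hc]
    calc _ ≤ ∫ x, |x - clampBCF n x| ∂(μ : Measure ℝ) := abs_integral_le_integral_abs
      _ ≤ ∫ x, ((n : ℝ) + 1) ^ (1 - γ) * |x| ^ γ ∂(μ : Measure ℝ) :=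
        integral_mono (hi.sub hc).abs ((h _ hμ).1.const_mul _) fun x => abs_sub_clampBCF_le hγ n x
      _ = ((n : ℝ) + 1) ^ (1 - γ) * ∫ x, |x| ^ γ ∂(μ : Measure ℝ) := integral_const_mul _ _
      _ ≤ _ := by gcongr; exact (h _ hμ).2
  refine hunif.continuousOn (Eventually.of_forall fun n => ?_).frequently
  exact (ProbabilityMeasure.continuous_integral_boundedContinuousFunction
    (clampBCF n)).continuousOn

end MomentBound

namespace SublinearExpectation

variable {E : SublinearExpectation (ℕ → ℝ)}

/-- Prokhorov: the set is tight, and closed as an intersection of weakly closed half-spaces. -/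
theorem isCompact_marginals {γ C : ℝ} (h : MomentBound E.marginals γ C) (hγ : 1 < γ) :
    IsCompact {μ : ProbabilityMeasure ℝ | (μ : Measure ℝ) ∈ E.marginals} := by
  set S := {μ : ProbabilityMeasure ℝ | (μ : Measure ℝ) ∈ E.marginals} with hS
  have hclosed : IsClosed S := by
    have : S = ⋂ (ψ : ℝ →ᵇ ℝ) (_ : ∃ K : ℝ≥0, LipschitzWith K ψ),
        {μ : ProbabilityMeasure ℝ | ∫ x, ψ x ∂(μ : Measure ℝ) ≤ E (ψ.compContinuous (coord 0))} := by
      ext μ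
      simp only [Set.mem_iInter]
      exact ⟨fun hμ => hμ.2, fun hμ => ⟨inferInstance, hμ⟩⟩
    rw [this]
    exact isClosed_biInter fun ψ _ => isClosed_le
      (ProbabilityMeasure.continuous_integral_boundedContinuousFunction ψ) continuous_const
  rw [← hclosed.closure_eq]
  refine isCompact_closure_of_isTightMeasureSet ?_
  refine (h.isTightMeasureSet hγ fun ν hν => hν.1).subset ?_
  rintro _ ⟨μ, hμ, rfl⟩
  exact hμ

/-- The integrals of the bounded continuous functions, and the mean, of a measure on `ℝ`. -/
noncomputable def integrals (μ : Measure ℝ) : Option (ℝ →ᵇ ℝ) → ℝ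
  | none => ∫ x, x ∂μ
  | some f => ∫ x, f x ∂μ

/-- The map `Φ` sends the marginals to a compact set in a product of real lines, a locally convex
space. Krein–Milman yields an extreme point of the exposed face where σ times the mean is maximal;
it is extreme in the whole image, and `Φ` is affine and injective, so extremality pulls back. -/
theorem exists_extremePoints_isMax {γ C : ℝ} (h : MomentBound E.marginals γ C) (hγ : 1 < γ)
    (hne : E.marginals.Nonempty) (σ : ℝ) :
    ∃ ν ∈ Set.extremePoints ℝ≥0 E.marginals,
      ∀ ν' ∈ E.marginals, σ * ∫ x, x ∂ν' ≤ σ * ∫ x, x ∂ν := by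
  set S := {μ : ProbabilityMeasure ℝ | (μ : Measure ℝ) ∈ E.marginals} with hS
  let Φ : ProbabilityMeasure ℝ → Option (ℝ →ᵇ ℝ) → ℝ := fun μ => integrals μ
  have hΦ : ContinuousOn Φ S := by
    refine continuousOn_pi.2 fun o => ?_
    cases o with
    | none => exact h.continuousOn_integral hγ
    | some f =>
      exact (ProbabilityMeasure.continuous_integral_boundedContinuousFunction f).continuousOn
  have hcomp : IsCompact (Φ '' S) := (isCompact_marginals h hγ).image_of_continuousOn hΦ
  -- The `none` coordinate records the mean, making it a continuous linear functional although x ↦ x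
  -- is unbounded.
  let l : StrongDual ℝ (Option (ℝ →ᵇ ℝ) → ℝ) := σ • ContinuousLinearMap.proj none
  have hl : ∀ v, l v = σ * v none := fun v => rfl
  have hexp : IsExposed ℝ (Φ '' S) (l.toExposed (Φ '' S)) :=
    ContinuousLinearMap.toExposed.isExposed
  have hneS : (Φ '' S).Nonempty := by
    obtain ⟨ν, hν⟩ := hne
    exact ⟨_, ⟨ν, hν.1⟩, hν, rfl⟩
  have hneB : (l.toExposed (Φ '' S)).Nonempty := by
    obtain ⟨v, hv, hmax⟩ := hcomp.exists_isMaxOn hneS l.continuous.continuousOn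
    exact ⟨v, hv, fun w hw => hmax hw⟩
  obtain ⟨v, hv⟩ := (hexp.isCompact hcomp).extremePoints_nonempty hneB
  have hvmax := hv.1.2
  have hvext := hexp.isExtreme.extremePoints_subset_extremePoints hv
  obtain ⟨⟨μ, hμ, rfl⟩, hvext⟩ := hvext
  refine ⟨μ, ⟨hμ, fun ν₁ h₁ ν₂ h₂ hseg => ?_⟩, fun ν' hν' => ?_⟩
  · obtain ⟨a, b, ha, hb, hab, heq⟩ := hseg
    have := h₁.1
    have := h₂.1
    have hlin : ∀ f : ℝ → ℝ, Integrable f ν₁ → Integrable f ν₂ →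
        a * ∫ x, f x ∂ν₁ + b * ∫ x, f x ∂ν₂ = ∫ x, f x ∂(μ : Measure ℝ) := by
      intro f hf₁ hf₂
      rw [← heq, integral_add_measure hf₁.smul_measure_nnreal hf₂.smul_measure_nnreal,
        integral_smul_nnreal_measure, integral_smul_nnreal_measure]
      rfl
    have hΦeq := hvext
      (Set.mem_image_of_mem Φ (show (⟨ν₁, h₁.1⟩ : ProbabilityMeasure ℝ) ∈ S from h₁))
      (Set.mem_image_of_mem Φ (show (⟨ν₂, h₂.1⟩ : ProbabilityMeasure ℝ) ∈ S from h₂))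
      ⟨a, b, by exact_mod_cast ha, by exact_mod_cast hb, by exact_mod_cast hab, by
        ext o
        cases o with
        | none => exact hlin _ (h.integrable hγ h₁) (h.integrable hγ h₂)
        | some f => exact hlin _ (f.integrable _) (f.integrable _)⟩
    exact ext_of_forall_integral_eq_of_IsFiniteMeasure fun f => congrFun hΦeq (some f)
  · exact hvmax _ ⟨⟨ν', hν'.1⟩, hν', rfl⟩

end SublinearExpectation

/-! ### Strong law with prescribed frequencies. -/

section Cesaro

open ProbabilityTheory

theorem tendsto_sum_range_div_of_eventually_zero {c : ℕ → ℝ} {d : ℕ} (h : ∀ k, d ≤ k → c k = 0) :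
    Tendsto (fun n : ℕ => (∑ k ∈ Finset.range n, c k) / n) atTop (𝓝 0) := by
  refine (tendsto_const_div_atTop_nhds_zero_nat (∑ k ∈ Finset.range d, c k)).congr' ?_
  filter_upwards [eventually_ge_atTop d] with n hn
  rw [Finset.sum_subset (Finset.range_subset_range.2 hn) fun k _ hk =>
    h k (by simpa using hk)]

theorem sum_range_ite_eq_sum_nth (p : ℕ → Prop) [DecidablePred p] (f : ℕ → ℝ) (n : ℕ) :
    ∑ k ∈ Finset.range n, (if p k then f k else 0) =
      ∑ i ∈ Finset.range (Nat.count p n), f (Nat.nth p i) := by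
  induction n with
  | zero => simp
  | succ n ih =>
    rw [Finset.sum_range_succ, ih, Nat.count_succ]
    split_ifs with h
    · rw [Finset.sum_range_succ, Nat.nth_count h]
    · simp

/-- The strong law of large numbers along the indices satisfying a predicate of density `t`. -/
theorem ae_tendsto_sum_range_ite_div {Ω : Type*} [MeasurableSpace Ω] {μ : Measure Ω}
    {X : ℕ → Ω → ℝ} (hint : ∀ k, Integrable (X k) μ)
    (hindep : Pairwise (Function.onFun (fun f g => IndepFun f g μ) X))
    (hident : ∀ i j, IdentDistrib (X i) (X j) μ μ) (p : ℕ → Prop) [DecidablePred p] {t : ℝ}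
    (hp : Tendsto (fun n : ℕ => (Nat.count p n : ℝ) / n) atTop (𝓝 t)) :
    ∀ᵐ ω ∂μ, Tendsto (fun n : ℕ => (∑ k ∈ Finset.range n, if p k then X k ω else 0) / n) atTop
      (𝓝 (t * ∫ ω, X 0 ω ∂μ)) := by
  -- With finitely many indices `Nat.nth` eventually takes its default value 0, so no subsequence is
  -- available; but then `t = 0` and the averages vanish.
  by_cases hfin : (Set.ofPred p).Finite
  · obtain ⟨d, hd⟩ := hfin.bddAbove
    have hnot : ∀ k, d + 1 ≤ k → ¬ p k := fun k hk hpk => by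
      have := hd (show k ∈ Set.ofPred p from hpk)
      omega
    have ht : t = 0 := by
      refine tendsto_nhds_unique hp ?_
      have h0 := tendsto_sum_range_div_of_eventually_zero (d := d + 1)
        (c := fun k => if p k then (1 : ℝ) else 0) fun k hk => if_neg (hnot k hk)
      refine h0.congr fun n => ?_
      rw [sum_range_ite_eq_sum_nth p (fun _ => (1 : ℝ))]
      simp
    refine Eventually.of_forall fun ω => ?_
    rw [ht, zero_mul]
    exact tendsto_sum_range_div_of_eventually_zero (d := d + 1) fun k hk => if_neg (hnot k hk)
  · have hinf : (Set.ofPred p).Infinite := hfin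
    have hlaw := strong_law_ae_real (fun i => X (Nat.nth p i)) (hint _)
      (fun i j hij => hindep ((Nat.nth_injective hinf).ne hij)) fun i => hident _ _
    rw [(hident (Nat.nth p 0) 0).integral_eq] at hlaw
    have hcount : Tendsto (Nat.count p) atTop atTop := by
      refine tendsto_atTop_atTop.2 fun b => ⟨Nat.nth p b, fun n hn => ?_⟩
      calc b = Nat.count p (Nat.nth p b) := (Nat.count_nth_of_infinite hinf b).symm
        _ ≤ _ := Nat.count_monotone p hn
    filter_upwards [hlaw] with ω hω
    rw [mul_comm]
    refine ((hω.comp hcount).mul hp).congr fun n => ?_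
    rw [sum_range_ite_eq_sum_nth p fun k => X k ω]
    rcases Nat.eq_zero_or_pos (Nat.count p n) with h0 | h0
    · simp [h0]
    · have : (Nat.count p n : ℝ) ≠ 0 := by positivity
      simp only [Function.comp_apply]
      field_simp

/-- For 0 ≤ t ≤ 1 the sequence ⌊t k⌋ moves by 0 or 1 at each step, so counting its jumps recovers
it. The jump times thus have density t. -/
theorem count_floor_lt {t : ℝ} (h0 : 0 ≤ t) (h1 : t ≤ 1)
    [DecidablePred fun k : ℕ => ⌊t * k⌋₊ < ⌊t * (k + 1 : ℕ)⌋₊] (n : ℕ) :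
    Nat.count (fun k : ℕ => ⌊t * k⌋₊ < ⌊t * (k + 1 : ℕ)⌋₊) n = ⌊t * n⌋₊ := by
  induction n with
  | zero => simp
  | succ n ih =>
    rw [Nat.count_succ, ih]
    have hle : ⌊t * n⌋₊ ≤ ⌊t * (n + 1 : ℕ)⌋₊ := by
      refine Nat.floor_le_floor ?_
      push_cast
      nlinarith
    have hup : ⌊t * (n + 1 : ℕ)⌋₊ ≤ ⌊t * n⌋₊ + 1 := by
      rw [← Nat.floor_add_one (by positivity)]
      refine Nat.floor_le_floor ?_
      push_cast
      linarith
    split_ifs with h <;> omega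

theorem count_add_count_not (p : ℕ → Prop) [DecidablePred p] (n : ℕ) :
    Nat.count p n + Nat.count (fun k => ¬ p k) n = n := by
  induction n with
  | zero => simp
  | succ n ih =>
    rw [Nat.count_succ, Nat.count_succ]
    split_ifs <;> omega

variable {ν₁ ν₂ : Measure ℝ} [IsProbabilityMeasure ν₁] [IsProbabilityMeasure ν₂]

theorem ae_tendsto_infinitePi {β : Type*} [MeasurableSpace β] {ρ : Measure β}
    [IsProbabilityMeasure ρ] {f : β → ℝ} (hf : Measurable f) (hint : Integrable f ρ)
    (p : ℕ → Prop) [DecidablePred p] {t : ℝ}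
    (hp : Tendsto (fun n : ℕ => (Nat.count p n : ℝ) / n) atTop (𝓝 t)) :
    ∀ᵐ w ∂(Measure.infinitePi fun _ : ℕ => ρ),
      Tendsto (fun n : ℕ => (∑ k ∈ Finset.range n, if p k then f (w k) else 0) / n) atTop
        (𝓝 (t * ∫ x, f x ∂ρ)) := by
  have hmp : ∀ k, MeasurePreserving (fun w : ℕ → β => w k) (Measure.infinitePi fun _ : ℕ => ρ) ρ :=
    fun k => measurePreserving_eval_infinitePi (fun _ : ℕ => ρ) k
  have hindep : iIndepFun (fun (k : ℕ) (w : ℕ → β) => f (w k))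
      (Measure.infinitePi fun _ : ℕ => ρ) :=
    iIndepFun_infinitePi (X := fun _ => f) fun _ => hf
  have h := ae_tendsto_sum_range_ite_div (X := fun k (w : ℕ → β) => f (w k))
    (fun k => (hmp k).integrable_comp_of_integrable hint)
    (fun i j hij => hindep.indepFun hij)
    (fun i j => ⟨(hf.comp (measurable_pi_apply i)).aemeasurable,
      (hf.comp (measurable_pi_apply j)).aemeasurable, by
        change Measure.map (f ∘ fun w : ℕ → β => w i) _ = Measure.map (f ∘ fun w : ℕ → β => w j) _
        rw [← Measure.map_map hf (measurable_pi_apply i),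
          ← Measure.map_map hf (measurable_pi_apply j), (hmp i).map_eq, (hmp j).map_eq]⟩) p hp
  have hmean : ∫ w : ℕ → β, f (w 0) ∂(Measure.infinitePi fun _ : ℕ => ρ) = ∫ x, f x ∂ρ := by
    rw [← integral_map (φ := fun w : ℕ → β => w 0) (hmp 0).measurable.aemeasurable
      hf.aestronglyMeasurable, (hmp 0).map_eq]
  rwa [hmean] at h

open Classical in
theorem ae_tendsto_empAvg_splice {d : ℕ} (A : ℕ → Set (Fin d → ℝ)) (ω : ℕ → ℝ) {t : ℝ}
    (h0 : 0 ≤ t) (h1 : t ≤ 1)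
    (hA : ∀ k : ℕ, firstCoords d ω ∈ A k ↔ ⌊t * k⌋₊ < ⌊t * (k + 1 : ℕ)⌋₊)
    (hν₁ : Integrable (fun x => x) ν₁) (hν₂ : Integrable (fun x => x) ν₂) :
    ∀ᵐ w ∂(Measure.infinitePi fun _ : ℕ => ν₁.prod ν₂),
      Tendsto (fun n => empAvg n (splice A (ω, w))) atTop
        (𝓝 (t * ∫ x, x ∂ν₁ + (1 - t) * ∫ x, x ∂ν₂)) := by
  have hp : Tendsto (fun n : ℕ => (Nat.count (fun k => firstCoords d ω ∈ A k) n : ℝ) / n) atTop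
      (𝓝 t) := by
    simp only [hA, count_floor_lt h0 h1]
    exact (tendsto_nat_floor_mul_div_atTop h0).comp tendsto_natCast_atTop_atTop
  have hp' : Tendsto (fun n : ℕ => (Nat.count (fun k => ¬ firstCoords d ω ∈ A k) n : ℝ) / n) atTop
      (𝓝 (1 - t)) := by
    refine (hp.const_sub 1).congr' ?_
    filter_upwards [eventually_gt_atTop 0] with n hn
    have hn' : (n : ℝ) ≠ 0 := by positivity
    have hc : (Nat.count (fun k => firstCoords d ω ∈ A k) n : ℝ) +
        Nat.count (fun k => ¬ firstCoords d ω ∈ A k) n = n := by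
      exact_mod_cast count_add_count_not (fun k => firstCoords d ω ∈ A k) n
    field_simp
    linarith
  have hi₁ : Integrable (fun x : ℝ × ℝ => x.1) (ν₁.prod ν₂) := hν₁.comp_fst ν₂
  have hi₂ : Integrable (fun x : ℝ × ℝ => x.2) (ν₁.prod ν₂) := hν₂.comp_snd ν₁
  have hm₁ : ∫ x : ℝ × ℝ, x.1 ∂(ν₁.prod ν₂) = ∫ x, x ∂ν₁ := by
    simpa using integral_fun_fst (μ := ν₁) (ν := ν₂) (fun x : ℝ => x)
  have hm₂ : ∫ x : ℝ × ℝ, x.2 ∂(ν₁.prod ν₂) = ∫ x, x ∂ν₂ := by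
    simpa using integral_fun_snd (μ := ν₁) (ν := ν₂) (fun x : ℝ => x)
  have hl₁ := ae_tendsto_infinitePi measurable_fst hi₁ _ hp
  have hl₂ := ae_tendsto_infinitePi measurable_snd hi₂ _ hp'
  rw [hm₁] at hl₁
  rw [hm₂] at hl₂
  filter_upwards [hl₁, hl₂] with w hw₁ hw₂
  -- The two strong laws use draws also at times k < d; this correction restores the true first d
  -- coordinates and disappears in the average.
  have hz := tendsto_sum_range_div_of_eventually_zero (d := d)
    (c := fun k => if k < d then
      ω k - (if firstCoords d ω ∈ A k then (w k).1 else (w k).2) else 0)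
    fun k hk => if_neg (by omega)
  rw [← add_zero (t * _ + _)]
  refine ((hw₁.add hw₂).add hz).congr fun n => ?_
  rw [empAvg, ← add_div, ← add_div, ← Finset.sum_add_distrib, ← Finset.sum_add_distrib]
  congr 1
  refine Finset.sum_congr rfl fun k _ => ?_
  rw [coord_apply, splice]
  by_cases hk : k < d <;> by_cases hmem : firstCoords d ω ∈ A k <;> simp [hk, hmem]

end Cesaro

theorem measurable_empAvg (n : ℕ) : Measurable (empAvg n) :=
  (Finset.measurable_sum _ fun k _ => measurable_coord k).div_const _

theorem ae_spliceMeasure_tendsto {d : ℕ} {A : ℕ → Set (Fin d → ℝ)}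
    (hA : ∀ k, MeasurableSet (A k)) {P : Measure (ℕ → ℝ)} [IsProbabilityMeasure P]
    {ν₁ ν₂ : Measure ℝ} [IsProbabilityMeasure ν₁] [IsProbabilityMeasure ν₂]
    {π : (Fin d → ℝ) → ℝ} (hπ : Measurable π)
    (h : ∀ ω, ∀ᵐ w ∂(Measure.infinitePi fun _ : ℕ => ν₁.prod ν₂),
      Tendsto (fun n => empAvg n (splice A (ω, w))) atTop (𝓝 (π (firstCoords d ω)))) :
    ∀ᵐ ω ∂(spliceMeasure A P ν₁ ν₂),
      Tendsto (fun n => empAvg n ω) atTop (𝓝 (π (firstCoords d ω))) := by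
  have hS : MeasurableSet
      {ω | Tendsto (fun n => empAvg n ω) atTop (𝓝 (π (firstCoords d ω)))} :=
    measurableSet_tendsto_fun measurable_empAvg (hπ.comp (measurable_firstCoords d))
  rw [spliceMeasure, ae_map_iff (measurable_splice hA).aemeasurable hS]
  refine (Measure.ae_prod_iff_ae_ae (measurable_splice hA hS)).2 ?_
  refine Eventually.of_forall fun ω => ?_
  filter_upwards [h ω] with w hw
  rwa [firstCoords_splice]

/-! ### Identification of μ̅ and μ̲, and conclusion. -/

namespace SublinearExpectation

variable {E : SublinearExpectation (ℕ → ℝ)}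

theorem upperExp_mul_coord (hreg : E.IsRegular) (hiid : E.CanonicalIID)
    (hne : E.Theta.Nonempty) (σ : ℝ) {ν : Measure ℝ} (hν : ν ∈ E.marginals)
    (hmax : ∀ ν' ∈ E.marginals, σ * ∫ x, x ∂ν' ≤ σ * ∫ x, x ∂ν) :
    E.upperExp (fun ω => σ * coord 0 ω) = σ * ∫ x, x ∂ν := by
  have hmean : ∀ P : Measure (ℕ → ℝ),
      ∫ ω, σ * coord 0 ω ∂P = σ * ∫ x, x ∂(P.map (coord 0)) := fun P => by
    rw [integral_const_mul, integral_map (f := fun x : ℝ => x) (measurable_coord 0).aemeasurable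
      measurable_id.aestronglyMeasurable]
  refine IsGreatest.csSup_eq ⟨?_, ?_⟩
  · obtain ⟨P, hP, rfl⟩ := (mem_marginals_iff hreg hiid hne).1 hν
    exact ⟨P, hP, hmean P⟩
  · rintro _ ⟨P, hP, rfl⟩
    change ∫ ω, σ * coord 0 ω ∂P ≤ _
    rw [hmean]
    exact hmax _ (map_coord_mem_marginals hP)

end SublinearExpectation

theorem mainTheorem5 (E : SublinearExpectation (ℕ → ℝ)) (hreg : E.IsRegular)
    (hiid : E.CanonicalIID) (γ : ℝ) (hγ : 1 < γ) (hL : ∀ k, E.MemLpE γ (coord k))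
    (d : ℕ) (π : (Fin d → ℝ) → ℝ) (hπ : Measurable π)
    (hπ_mem : ∀ x, π x ∈ Set.Icc E.muLower E.muUpper)
    (P : Measure (ℕ → ℝ)) (hP : P ∈ E.Theta) :
    (∃ Q ∈ E.Theta,
      (∀ A, MeasurableSet[sigmaFirst d] A → Q A = P A) ∧
      ∀ᵐ ω ∂Q, Tendsto (fun n => empAvg n ω) atTop (𝓝 (π (firstCoords d ω)))) ∧
    (P.map (firstCoords d) ∈ Set.extremePoints ℝ≥0 (E.Xi d) →
      ∃ Q ∈ Set.extremePoints ℝ≥0 E.Theta,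
        (∀ A, MeasurableSet[sigmaFirst d] A → Q A = P A) ∧
        ∀ᵐ ω ∂Q, Tendsto (fun n => empAvg n ω) atTop (𝓝 (π (firstCoords d ω)))) := by
  have hne : E.Theta.Nonempty := ⟨P, hP⟩
  have := hP.1
  obtain ⟨C, hC⟩ := SublinearExpectation.exists_momentBound_marginals hreg hiid hne hγ (hL 0)
  have hne' : E.marginals.Nonempty := ⟨_, SublinearExpectation.map_coord_mem_marginals hP⟩
  obtain ⟨ν₁, hν₁, hmax₁⟩ := SublinearExpectation.exists_extremePoints_isMax hC hγ hne' 1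
  obtain ⟨ν₂, hν₂, hmax₂⟩ := SublinearExpectation.exists_extremePoints_isMax hC hγ hne' (-1)
  have := hν₁.1.1
  have := hν₂.1.1
  have hup : E.muUpper = ∫ x, x ∂ν₁ := by
    simpa [SublinearExpectation.muUpper] using
      SublinearExpectation.upperExp_mul_coord hreg hiid hne 1 hν₁.1 hmax₁
  have hlow : E.muLower = ∫ x, x ∂ν₂ := by
    have := SublinearExpectation.upperExp_mul_coord hreg hiid hne (-1) hν₂.1 hmax₂
    simp only [neg_one_mul] at this
    rw [SublinearExpectation.muLower, this, neg_neg]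
  -- The weight writing π as a mixture of the two means. If they coincide, division by zero gives 0,
  -- and π is forced to be their common value.
  let τ : (Fin d → ℝ) → ℝ := fun x => (π x - E.muLower) / (E.muUpper - E.muLower)
  have hτ : Measurable τ := (hπ.sub_const _).div_const _
  have hτ0 : ∀ x, 0 ≤ τ x := fun x =>
    div_nonneg (sub_nonneg.2 (hπ_mem x).1) (sub_nonneg.2 ((hπ_mem x).1.trans (hπ_mem x).2))
  have hτ1 : ∀ x, τ x ≤ 1 := fun x =>
    div_le_one_of_le₀ (sub_le_sub_right (hπ_mem x).2 _)
      (sub_nonneg.2 ((hπ_mem x).1.trans (hπ_mem x).2))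
  have hτπ : ∀ x, τ x * E.muUpper + (1 - τ x) * E.muLower = π x := by
    intro x
    have h : τ x * (E.muUpper - E.muLower) = π x - E.muLower := by
      rcases eq_or_ne (E.muUpper - E.muLower) 0 with h | h
      · have := hπ_mem x
        rw [h, mul_zero]
        linarith [this.1, this.2]
      · exact div_mul_cancel₀ _ h
    linarith
  -- ν₁ is drawn at the jump times of ⌊τ k⌋, hence with frequency τ.
  let A : ℕ → Set (Fin d → ℝ) := fun k => {x | ⌊τ x * k⌋₊ < ⌊τ x * (k + 1 : ℕ)⌋₊}
  have hA : ∀ k, MeasurableSet (A k) := fun k =>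
    measurableSet_lt (hτ.mul_const _).nat_floor (hτ.mul_const _).nat_floor
  have hagree : ∀ B, MeasurableSet[sigmaFirst d] B → spliceMeasure A P ν₁ ν₂ B = P B := by
    rintro _ ⟨s, hs, rfl⟩
    rw [← Measure.map_apply (measurable_firstCoords d) hs, spliceMeasure_map_firstCoords hA,
      Measure.map_apply (measurable_firstCoords d) hs]
  have hlim : ∀ᵐ ω ∂(spliceMeasure A P ν₁ ν₂),
      Tendsto (fun n => empAvg n ω) atTop (𝓝 (π (firstCoords d ω))) := by
    refine ae_spliceMeasure_tendsto hA hπ fun ω => ?_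
    rw [← hτπ, hup, hlow]
    exact ae_tendsto_empAvg_splice A ω (hτ0 _) (hτ1 _) (fun k => Iff.rfl)
      (hC.integrable hγ hν₁.1) (hC.integrable hγ hν₂.1)
  exact ⟨⟨_, SublinearExpectation.spliceMeasure_mem_Theta hreg hiid hA hP hν₁.1 hν₂.1, hagree,
    hlim⟩, fun hPd => ⟨_, SublinearExpectation.spliceMeasure_mem_extremePoints hreg hiid hA hP hPd
      hν₁ hν₂, hagree, hlim⟩⟩
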